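/- Let $G$ be a discrete group with a group homomorphism $l\colon G\to\mathbb R$ that is proper (every set $\{g: -m\le l(g)\le m\}$, $m\in\mathbb N$, is finite). Let $A$ be a unital $C^*$-algebra with an action $\alpha$ of $G$, and let $(\mathcal A,H,D,\pi)$ be an odd or even spectral triple on $A$ which is $G$-invariant: there is a unitary representation $u$ of $G$ on $H$ with $\pi(\alpha_g(a))=u_g\pi(a)u_g^*$, $u_g(\mathrm{Dom}\,D)\subseteq \mathrm{Dom}\,D$ and $[D,u_g]=0$ and, in the even case, $[\chi,u_g]=0$ for the grading $\chi$. Let $J$ be a real structure of KO-dimension $n\in\mathbb Z_8$ on it ($n$ odd for odd triples, even for even triples), so that $J$ is antiunitary, $[\pi(a),J\pi(b)J^{-1}]=0$ for all $a,b\in A$, $J^2=\varepsilon$, $DJ=\varepsilon' JD$ and (for $n$ even) $\chi J=\varepsilon'' J\chi$, with signs $(\varepsilon,\varepsilon',\varepsilon'')$ equal for $n=0,\dots,7$ to $(+,+,+),(+,-),(-,+,-),(-,+),(-,+,+),(-,-),(+,+,-),(+,+)$. Assume that $J$ is unitarily invariant, $u_gJu_g^*=J$ for all $g\in G$. Let $M_l$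 be multiplication by $l$ on $\ell^2(G)$. If $n$ is odd put $\widehat H=H\otimes\ell^2(G)\otimes\mathbb C^2$, $\widehat D=D\otimes1\otimes\sigma_1+1\otimes M_l\otimes\sigma_2$ and $\widehat\chi=\sigma_3$ (acting on $\mathbb C^2$), with the Pauli matrices $\sigma_1,\sigma_2,\sigma_3$; if $n$ is even put $\widehat H=H\otimes\ell^2(G)$, $\widehat D=D\otimes 1+\chi\otimes M_l$ and $\widehat\chi=1$. Let $A\rtimes_{\alpha,r}G$ act on $\widehat H$ (diagonally in $\mathbb C^2$ if $n$ is odd) by $a\delta_h\cdot(\xi\otimes\delta_g)=\pi(a)u_h\xi\otimes\delta_{hg}$. With the antilinear map $j(\xi\otimes\delta_g)=u_g^*J\xi\otimes\delta_{g^{-1}}$ on $H\otimes\ell^2(G)$ and complex conjugation $cc$ on $\mathbb C^2$, let $$\widehat J=j\otimes cc\ (n=3,7),\quad \widehat J=j\otimes (cc\circ\sigma_2)\ (n=1,5),\quad \widehat J=(\chi\otimes1)j\ (n=0,4),\quad \widehat J=j\ (n=2,6).$$ Let $U$ be the unitary $U(\xi\otimes\delta_x\otimes\delta_g)=\xi\otimes\delta_x\otimes\delta_{xg}$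 of the Hilbert module $\widehat H\otimes C^*_r(G)$ (diagonal in $\mathbb C^2$ if $n$ is odd). Then $\widehat J$ is an equivariant real structure for the dual coaction $\widehat\alpha(a\delta_h)=a\delta_h\otimes\delta_h$ of $G$ on $A\rtimes_{\alpha,r}G$. That is: 1. $U$ is a unitary corepresentation of $C^*_r(G)$ on $\widehat H$, $(\mathrm{id}\otimes\Delta)(U)=U_{12}U_{13}$ with $\Delta(\delta_g)=\delta_g\otimes\delta_g$, which makes the triple equivariant for $\widehat\alpha$: $U(b\,\eta\otimes1)=\widehat\alpha(b)\,U(\eta\otimes1)$ for all $b\in A\rtimes_{\alpha,r}G$ and $\eta\in\widehat H$; $U$ commutes with $\widehat D\otimes1$ and $\widehat\chi\otimes1$; and $(\mathrm{id}\otimes\varphi)(U(b\otimes1)U^*)$ lies in the bicommutant of $A\rtimes_{\alpha,r}G$ on $\widehat H$ for every such $b$ and every state $\varphi$ of $C^*_r(G)$. 2. $\widehat J$ is a real structure of KO-dimension $n+1$ for $A\rtimes_{\alpha,r}G$, $\widehat D$ and $\widehat\chi$. 3. $(\widehat J\otimes *)\,U=U\,(\widehat J\otimes 1)$ on $\widehat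 H\otimes 1$, where $\widehat J\otimes *$ is the closure of the (closable) antilinear map $\sum_i\xi_i\otimes b_i\mapsto\sum_i\widehat J\xi_i\otimes b_i^*$ on the algebraic tensor product of $\widehat H$ and $C^*_r(G)$. For $n$ even the equation in 3 also holds with $\chi J\otimes J_G$ ($n=0,4$), respectively $J\otimes J_G$ ($n=2,6$), in place of $\widehat J$, where $J_G$ is the antilinear isometry of $\ell^2(G)$ with $J_G\delta_g=\delta_{g^{-1}}$. -/

import Mathlib

open scoped ENNReal InnerProductSpace ComplexOrder

noncomputable section

namespace CrossedTriple

/-! ### The Hilbert spaces `H ⊗ ℓ²(I)` -/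

/-- `ℓ²(I; E)`, the standard model of the Hilbert space tensor product `E ⊗ ℓ²(I)`;
`ξ ⊗ δ_i` is `lp.single 2 i ξ`. -/
abbrev Ell2 (I : Type*) (E : Type*) [NormedAddCommGroup E] : Type _ := lp (fun _ : I => E) 2

section Tools

variable {I I' : Type*} {E E' : Type*} [NormedAddCommGroup E] [NormedAddCommGroup E']

theorem memlp_two_iff {f : I → E} : Memℓp f 2 ↔ Summable fun i => ‖f i‖ ^ 2 := by
  rw [memℓp_gen_iff (by norm_num : 0 < (2 : ℝ≥0∞).toReal)]
  simp

theorem summable_sq (x : Ell2 I E) : Summable fun i => ‖x i‖ ^ 2 :=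
  memlp_two_iff.1 (lp.memℓp x)

theorem norm_sq_eq (x : Ell2 I E) : ‖x‖ ^ 2 = ∑' i, ‖x i‖ ^ 2 := by
  have h := lp.norm_rpow_eq_tsum (by norm_num : 0 < (2 : ℝ≥0∞).toReal) x
  simpa using h

theorem norm_eq_of_tsum (x : Ell2 I E) (y : Ell2 I' E')
    (h : ∑' i, ‖x i‖ ^ 2 = ∑' i, ‖y i‖ ^ 2) : ‖x‖ = ‖y‖ := by
  rw [← norm_sq_eq, ← norm_sq_eq] at h
  exact (sq_eq_sq₀ (norm_nonneg _) (norm_nonneg _)).1 h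

variable [NormedSpace ℂ E] [NormedSpace ℂ E']

/-- The (anti)unitary `(T x)(i) = e i (x (p i))`: relabel the index set by `p` and apply in each
fibre an (anti)unitary `e i`. -/
def lpTwist {σ : ℂ →+* ℂ} [RingHomInvPair σ σ] (p : I' ≃ I) (e : I' → E ≃ₛₗᵢ[σ] E') :
    Ell2 I E ≃ₛₗᵢ[σ] Ell2 I' E' where
  toFun x := ⟨fun i => e i (x (p i)), memlp_two_iff.2 <| by
    simpa [Function.comp_def] using p.summable_iff.2 (summable_sq x)⟩
  map_add' x y := lp.ext (funext fun i => map_add (e i) (x (p i)) (y (p i)))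
  map_smul' c x := lp.ext (funext fun i => (e i).map_smulₛₗ c (x (p i)))
  invFun y := ⟨fun j => (e (p.symm j)).symm (y (p.symm j)), memlp_two_iff.2 <| by
    simpa [Function.comp_def] using p.symm.summable_iff.2 (summable_sq y)⟩
  left_inv x := by ext j; simp
  right_inv y := by
    ext i
    change e i ((e (p.symm (p i))).symm (y (p.symm (p i)))) = y i
    rw [p.symm_apply_apply]
    simp
  norm_map' x := by
    refine norm_eq_of_tsum _ _ ?_
    have := p.tsum_eq (fun i => ‖x i‖ ^ 2)
    simpa using this

@[simp]
theorem lpTwist_apply {σ : ℂ →+* ℂ} [RingHomInvPair σ σ] (p : I' ≃ I)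
    (e : I' → E ≃ₛₗᵢ[σ] E') (x : Ell2 I E) (i : I') : lpTwist p e x i = e i (x (p i)) := rfl

/-- `T ⊗ 1` on `E ⊗ ℓ²(I)`: the operator `T` in every fibre. -/
def fibrewise (I : Type*) (T : E →L[ℂ] E') : Ell2 I E →L[ℂ] Ell2 I E' :=
  LinearMap.mkContinuous
    { toFun := fun x => ⟨fun i => T (x i), memlp_two_iff.2 <|
        Summable.of_nonneg_of_le (fun i => by positivity)
          (fun i => by
            have := T.le_opNorm (x i)
            calc ‖T (x i)‖ ^ 2 ≤ (‖T‖ * ‖x i‖) ^ 2 := by gcongr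
              _ = ‖T‖ ^ 2 * ‖x i‖ ^ 2 := by ring)
          ((summable_sq x).mul_left (‖T‖ ^ 2))⟩
      map_add' := fun x y => lp.ext (funext fun i => map_add T (x i) (y i))
      map_smul' := fun c x => lp.ext (funext fun i => map_smul T c (x i)) }
    ‖T‖ (fun x => by
      refine (sq_le_sq₀ (norm_nonneg _) (by positivity)).1 ?_
      rw [mul_pow, norm_sq_eq, norm_sq_eq, ← tsum_mul_left]
      refine Summable.tsum_le_tsum (fun i => ?_) (summable_sq _)
        ((summable_sq x).mul_left (‖T‖ ^ 2))
      have := T.le_opNorm (x i)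
      calc ‖T (x i)‖ ^ 2 ≤ (‖T‖ * ‖x i‖) ^ 2 := by gcongr
        _ = ‖T‖ ^ 2 * ‖x i‖ ^ 2 := by ring)

@[simp]
theorem fibrewise_apply (T : E →L[ℂ] E') (x : Ell2 I E) (i : I) :
    fibrewise I T x i = T (x i) := rfl

theorem summable_swap {J : Type*} (x : Ell2 (I × J) E) :
    Summable fun q : J × I => ‖x (q.2, q.1)‖ ^ 2 :=
  (Equiv.prodComm J I).summable_iff.2 (summable_sq x)

/-- The slice `i ↦ x (i, g)` of an element of `ℓ²(I × J; E)`. -/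
def sliceEll2 {J : Type*} (x : Ell2 (I × J) E) (g : J) : Ell2 I E :=
  ⟨fun i => x (i, g), memlp_two_iff.2 ((summable_swap x).prod_factor g)⟩

theorem norm_slice_sq {J : Type*} (x : Ell2 (I × J) E) (g : J) :
    ‖sliceEll2 x g‖ ^ 2 = ∑' i, ‖x (i, g)‖ ^ 2 :=
  norm_sq_eq _

theorem memlp_slice {J : Type*} (x : Ell2 (I × J) E) : Memℓp (fun g => sliceEll2 x g) 2 := by
  refine memlp_two_iff.2 ?_
  simp only [norm_slice_sq]
  exact (summable_swap x).prod

theorem memlp_uncurry {J : Type*} (y : Ell2 J (Ell2 I E)) :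
    Memℓp (fun q : I × J => y q.2 q.1) 2 := by
  refine memlp_two_iff.2 ?_
  have : Summable fun q : J × I => ‖y q.1 q.2‖ ^ 2 := by
    refine (summable_prod_of_nonneg (fun q => by positivity)).2
      ⟨fun g => summable_sq (y g), ?_⟩
    simp only [← norm_sq_eq]
    exact summable_sq y
  exact (Equiv.prodComm I J).summable_iff.2 this

theorem norm_curry {J : Type*} (x : Ell2 (I × J) E) :
    ‖(⟨fun g => sliceEll2 x g, memlp_slice x⟩ : Ell2 J (Ell2 I E))‖ = ‖x‖ := by
  refine norm_eq_of_tsum _ _ ?_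
  have h2 : ∑' q : J × I, ‖x (q.2, q.1)‖ ^ 2 = ∑' q : I × J, ‖x q‖ ^ 2 :=
    (Equiv.prodComm J I).tsum_eq (fun q : I × J => ‖x q‖ ^ 2)
  rw [← h2]
  change ∑' g, ‖sliceEll2 x g‖ ^ 2 = _
  simp only [norm_slice_sq]
  exact (summable_swap x).tsum_prod.symm

/-- The identification of `ℓ²(I × J; E)` with `ℓ²(J; ℓ²(I; E))`. -/
def curryEll2 (I J : Type*) (E : Type*) [NormedAddCommGroup E] [NormedSpace ℂ E] :
    Ell2 (I × J) E ≃ₗᵢ[ℂ] Ell2 J (Ell2 I E) where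
  toFun x := ⟨fun g => sliceEll2 x g, memlp_slice x⟩
  map_add' _ _ := rfl
  map_smul' _ _ := rfl
  invFun y := ⟨fun q => y q.2 q.1, memlp_uncurry y⟩
  left_inv _ := rfl
  right_inv _ := rfl
  norm_map' x := norm_curry x

@[simp]
theorem curryEll2_apply {J : Type*} (x : Ell2 (I × J) E) (g : J) (i : I) :
    curryEll2 I J E x g i = x (i, g) := rfl

@[simp]
theorem curryEll2_symm_apply {J : Type*} (y : Ell2 J (Ell2 I E)) (q : I × J) :
    (curryEll2 I J E).symm y q = y q.2 q.1 := rfl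

/-- `T ⊗ 1` on `(E ⊗ ℓ²(I)) ⊗ ℓ²(J)`, for a bounded operator `T` on `E ⊗ ℓ²(I)`. -/
def ampl (J : Type*) (T : Ell2 I E →L[ℂ] Ell2 I E) :
    Ell2 (I × J) E →L[ℂ] Ell2 (I × J) E :=
  ((curryEll2 I J E).symm.toContinuousLinearEquiv : Ell2 J (Ell2 I E) →L[ℂ] Ell2 (I × J) E) ∘L
    fibrewise J T ∘L
    ((curryEll2 I J E).toContinuousLinearEquiv : Ell2 (I × J) E →L[ℂ] Ell2 J (Ell2 I E))

/-- The operator `v ↦ ξ ⊗ v` from `ℓ²(J)` to `(E ⊗ ℓ²(I)) ⊗ ℓ²(J)`. -/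
def tensorLeft (J : Type*) (ξ : Ell2 I E) : Ell2 J ℂ →L[ℂ] Ell2 (I × J) E :=
  ((curryEll2 I J E).symm.toContinuousLinearEquiv : Ell2 J (Ell2 I E) →L[ℂ] Ell2 (I × J) E) ∘L
    fibrewise J (ContinuousLinearMap.toSpanSingleton ℂ ξ)

@[simp]
theorem tensorLeft_apply {J : Type*} (ξ : Ell2 I E) (v : Ell2 J ℂ) (i : I) (g : J) :
    tensorLeft J ξ v (i, g) = v g • ξ i := rfl

end Tools

/-! ### The reduced group C*-algebra and the Hilbert module `Ĥ ⊗ C*_r(G)` -/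

section Group

variable {G : Type*} [Group G]

/-- The left regular representation, `λ_g δ_h = δ_{gh}`. -/
def leftRegular (g : G) : Ell2 G ℂ →L[ℂ] Ell2 G ℂ :=
  (lpTwist (Equiv.mulLeft g⁻¹) (fun _ => LinearIsometryEquiv.refl ℂ ℂ) :
    Ell2 G ℂ ≃ₗᵢ[ℂ] Ell2 G ℂ).toContinuousLinearEquiv

variable (G) in
/-- `C*_r(G)`, the norm closed *-algebra on `ℓ²(G)` generated by the left regular
representation. -/
def reducedGroupAlgebra : StarSubalgebra ℂ (Ell2 G ℂ →L[ℂ] Ell2 G ℂ) :=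
  (StarAlgebra.adjoin ℂ (Set.range (leftRegular (G := G)))).topologicalClosure

variable {I : Type*} {E : Type*} [NormedAddCommGroup E] [InnerProductSpace ℂ E]

variable (G I E) in
/-- The Hilbert `C*_r(G)`-module `Ĥ ⊗ C*_r(G)` for the Hilbert space `Ĥ = ℓ²(I; E)`, in its
standard concrete form: since `C*_r(G)` acts on `ℓ²(G)`, the element `ξ ⊗ b` is the operator
`v ↦ ξ ⊗ b v` from `ℓ²(G)` to `Ĥ ⊗ ℓ²(G)`. The `C*_r(G)`-valued inner product is
`⟨z, w⟩ = z* w`, the right action is `z · b = z ∘ b` and the module norm is the operator norm. -/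
def hilbertModule : Submodule ℂ (Ell2 G ℂ →L[ℂ] Ell2 (I × G) E) :=
  (Submodule.span ℂ {z | ∃ (ξ : Ell2 I E) (b : Ell2 G ℂ →L[ℂ] Ell2 G ℂ),
    b ∈ reducedGroupAlgebra G ∧ z = tensorLeft G ξ ∘L b}).topologicalClosure

/-- The action `z ↦ X z` of a unitary `X` of `Ĥ ⊗ ℓ²(G)` on `Ĥ ⊗ C*_r(G)`. -/
def act (X : Ell2 (I × G) E ≃ₗᵢ[ℂ] Ell2 (I × G) E) (z : Ell2 G ℂ →L[ℂ] Ell2 (I × G) E) :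
    Ell2 G ℂ →L[ℂ] Ell2 (I × G) E :=
  (X.toContinuousLinearEquiv : Ell2 (I × G) E →L[ℂ] Ell2 (I × G) E) ∘L z

/-- The map `Θ(ξ) = X (ξ ⊗ 1)` from `Ĥ` to `Ĥ ⊗ C*_r(G)`. -/
def corepMap (X : Ell2 (I × G) E ≃ₗᵢ[ℂ] Ell2 (I × G) E) (ξ : Ell2 I E) :
    Ell2 G ℂ →L[ℂ] Ell2 (I × G) E :=
  act X (tensorLeft G ξ)

/-- The flip of the last two legs of `Ĥ ⊗ ℓ²(G) ⊗ ℓ²(G)`. -/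
def flip23 : Ell2 ((I × G) × G) E ≃ₗᵢ[ℂ] Ell2 ((I × G) × G) E :=
  lpTwist
    { toFun := fun q => ((q.1.1, q.2), q.1.2)
      invFun := fun q => ((q.1.1, q.2), q.1.2)
      left_inv := fun _ => rfl
      right_inv := fun _ => rfl }
    (fun _ => LinearIsometryEquiv.refl ℂ E)

/-- The unitary `ξ ⊗ δ_s ⊗ δ_t ↦ ξ ⊗ δ_s ⊗ δ_{st}`. On the last two legs it implements the
comultiplication `Δ(δ_g) = δ_g ⊗ δ_g`, as `Δ(b) = Y (b ⊗ 1) Y*`. -/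
def comult23 : Ell2 ((I × G) × G) E ≃ₗᵢ[ℂ] Ell2 ((I × G) × G) E :=
  lpTwist
    { toFun := fun q => (q.1, q.1.2⁻¹ * q.2)
      invFun := fun q => (q.1, q.1.2 * q.2)
      left_inv := fun q => by ext <;> simp
      right_inv := fun q => by ext <;> simp }
    (fun _ => LinearIsometryEquiv.refl ℂ E)

/-- `X` is a unitary corepresentation of `C*_r(G)` on `Ĥ`: a unitary operator of the Hilbert
module `Ĥ ⊗ C*_r(G)` with `(id ⊗ Δ)(X) = X₁₂ X₁₃`. (The adjointable operators of
`Ĥ ⊗ C*_r(G)` are the operators on `Ĥ ⊗ ℓ²(G)` that together with their adjoints map the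
module into itself by composition.) -/
structure IsUnitaryCorep (X : Ell2 (I × G) E ≃ₗᵢ[ℂ] Ell2 (I × G) E) : Prop where
  map_module : ∀ z, act X z ∈ hilbertModule G I E ↔ z ∈ hilbertModule G I E
  comult : ∀ y : Ell2 ((I × G) × G) E,
    comult23 (ampl G (X.toContinuousLinearEquiv : Ell2 (I × G) E →L[ℂ] Ell2 (I × G) E)
        (comult23.symm y)) =
      ampl G (X.toContinuousLinearEquiv : Ell2 (I × G) E →L[ℂ] Ell2 (I × G) E)
        (flip23 (ampl G (X.toContinuousLinearEquiv : Ell2 (I × G) E →L[ℂ] Ell2 (I × G) E)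
          (flip23 y)))

/-- The graph of the closed operator `D ⊗ 1` on `Ĥ ⊗ C*_r(G)`: the closure of the graph of
`D ⊗ 1` on the algebraic tensor product of the domain of `D` and `C*_r(G)`. -/
def tensorOneGraph (D : Ell2 I E →ₗ.[ℂ] Ell2 I E) :
    Set ((Ell2 G ℂ →L[ℂ] Ell2 (I × G) E) × (Ell2 G ℂ →L[ℂ] Ell2 (I × G) E)) :=
  closure (Submodule.span ℂ {q | ∃ (ξ : D.domain) (b : Ell2 G ℂ →L[ℂ] Ell2 G ℂ),
    b ∈ reducedGroupAlgebra G ∧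
      q = (tensorLeft G (ξ : Ell2 I E) ∘L b, tensorLeft G (D ξ) ∘L b)} : Set _)

/-- The graph of `J ⊗ *` on `Ĥ ⊗ C*_r(G)` for an antiunitary `J`: the closure of the graph of
the antilinear map `∑ ξ_i ⊗ b_i ↦ ∑ J ξ_i ⊗ b_i*` on the algebraic tensor product. (In general
`J ⊗ *` is unbounded for the norm of the Hilbert module.) -/
def tensorStarGraph (J : Ell2 I E ≃ₛₗᵢ[starRingEnd ℂ] Ell2 I E) :
    Set ((Ell2 G ℂ →L[ℂ] Ell2 (I × G) E) × (Ell2 G ℂ →L[ℂ] Ell2 (I × G) E)) :=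
  closure (AddSubgroup.closure {q | ∃ (ξ : Ell2 I E) (b : Ell2 G ℂ →L[ℂ] Ell2 G ℂ),
    b ∈ reducedGroupAlgebra G ∧
      q = (tensorLeft G ξ ∘L b, tensorLeft G (J ξ) ∘L star b)} : Set _)

/-- `(J ⊗ *) X = X (J ⊗ 1)` on `Ĥ ⊗ 1`: the relation `J ⊗ *` is the graph of a map, every
`X (ξ ⊗ 1)` lies in the domain of this map, and its value there is `X (J ξ ⊗ 1)`. -/
def Intertwines (X : Ell2 (I × G) E ≃ₗᵢ[ℂ] Ell2 (I × G) E)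
    (J : Ell2 I E ≃ₛₗᵢ[starRingEnd ℂ] Ell2 I E) : Prop :=
  (∀ z w w', (z, w) ∈ tensorStarGraph (G := G) J → (z, w') ∈ tensorStarGraph (G := G) J →
    w = w') ∧
  ∀ ξ : Ell2 I E, (act X (tensorLeft G ξ), act X (tensorLeft G (J ξ))) ∈ tensorStarGraph J

/-- The triple given by an algebra `B` of operators on `Ĥ`, a Dirac operator `D` and a grading
`χ` (`χ = 1` for odd triples) is equivariant for the coaction `θ` of `G` on `B` by means of the
unitary corepresentation `X`. Elements of `B ⊗ C*_r(G)` are operators on `Ĥ ⊗ ℓ²(G)`. -/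
structure IsCoactionEquivariant [CompleteSpace E]
    (B : StarSubalgebra ℂ (Ell2 I E →L[ℂ] Ell2 I E))
    (θ : B →⋆ₐ[ℂ] (Ell2 (I × G) E →L[ℂ] Ell2 (I × G) E))
    (D : Ell2 I E →ₗ.[ℂ] Ell2 I E) (χ : Ell2 I E ≃ₗᵢ[ℂ] Ell2 I E)
    (X : Ell2 (I × G) E ≃ₗᵢ[ℂ] Ell2 (I × G) E) : Prop where
  corep : IsUnitaryCorep X
  /-- `Θ(b ξ) = θ(b) Θ(ξ)`. -/
  covariant : ∀ (b : B) (ξ : Ell2 I E),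
    corepMap X ((b : Ell2 I E →L[ℂ] Ell2 I E) ξ) = θ b ∘L corepMap X ξ
  /-- `X` commutes with `D ⊗ 1`. -/
  commutes_dirac : ∀ z w, (z, w) ∈ tensorOneGraph D ↔ (act X z, act X w) ∈ tensorOneGraph D
  /-- `X` commutes with `χ ⊗ 1`. -/
  commutes_grading : ∀ y : Ell2 (I × G) E,
    X (ampl G (χ.toContinuousLinearEquiv : Ell2 I E →L[ℂ] Ell2 I E) y) =
      ampl G (χ.toContinuousLinearEquiv : Ell2 I E →L[ℂ] Ell2 I E) (X y)
  /-- `R = (id ⊗ φ)(X (b ⊗ 1) X*)` lies in `B''` for every state `φ` of `C*_r(G)`. -/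
  slice : ∀ φ : reducedGroupAlgebra G →L[ℂ] ℂ, (∀ b, 0 ≤ φ (star b * b)) → φ 1 = 1 →
    ∀ b ∈ B, ∃ R ∈ Set.centralizer (Set.centralizer (B : Set (Ell2 I E →L[ℂ] Ell2 I E))),
      ∀ ξ η : Ell2 I E, ∃ c : reducedGroupAlgebra G,
        (c : Ell2 G ℂ →L[ℂ] Ell2 G ℂ) =
          ContinuousLinearMap.adjoint (tensorLeft G ξ) ∘L
            act X (ampl G b ∘L act X.symm (tensorLeft G η)) ∧
        ⟪ξ, R η⟫_ℂ = φ c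

end Group

/-! ### Spectral triples and real structures -/

section Triples

variable {H : Type*} [NormedAddCommGroup H] [InnerProductSpace ℂ H]

/-- The sign `ε` of KO-dimension `n`. -/
def koEps (n : ZMod 8) : ℤ := (![1, 1, -1, -1, -1, -1, 1, 1] : Fin 8 → ℤ) n

/-- The sign `ε'` of KO-dimension `n`. -/
def koEps' (n : ZMod 8) : ℤ := (![1, -1, 1, 1, 1, -1, 1, 1] : Fin 8 → ℤ) n

/-- The sign `ε''` of KO-dimension `n`; it is only meaningful for even `n`, and is `1` for odd
`n` in accordance with the convention `χ = 1` for odd triples. -/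
def koEps'' (n : ZMod 8) : ℤ := (![1, 1, -1, 1, 1, 1, -1, 1] : Fin 8 → ℤ) n

/-- `J` is a real structure of KO-dimension `n` for the triple with represented algebra `S`,
Dirac operator `D` and grading `χ` (`χ = 1` for odd triples). -/
structure IsRealStructure (S : Set (H →L[ℂ] H)) (D : H →ₗ.[ℂ] H) (χ : H ≃ₗᵢ[ℂ] H) (n : ZMod 8)
    (J : H ≃ₛₗᵢ[starRingEnd ℂ] H) : Prop where
  zeroth_order : ∀ a ∈ S, ∀ b ∈ S, ∀ ξ, a (J (b (J.symm ξ))) = J (b (J.symm (a ξ)))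
  sq : ∀ ξ, J (J ξ) = koEps n • ξ
  domain : ∀ ξ, J ξ ∈ D.domain ↔ ξ ∈ D.domain
  dirac : ∀ (ξ : H) (hξ : ξ ∈ D.domain) (hJ : J ξ ∈ D.domain),
    D ⟨J ξ, hJ⟩ = koEps' n • J (D ⟨ξ, hξ⟩)
  grading : ∀ ξ, χ (J ξ) = koEps'' n • J (χ ξ)

variable [CompleteSpace H]

/-- `(𝒜, H, D, π)` is an odd spectral triple on the unital C*-algebra `A`. -/
structure IsSpectralTriple {A : Type*} [CStarAlgebra A] (𝒜 : StarSubalgebra ℂ A)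
    (π : A →⋆ₐ[ℂ] (H →L[ℂ] H)) (D : H →ₗ.[ℂ] H) : Prop where
  dense_algebra : Dense (𝒜 : Set A)
  dense_domain : Dense (D.domain : Set H)
  selfAdjoint : IsSelfAdjoint D
  /-- `T = (1 + D²)^{-1/2}` is compact. -/
  compact_resolvent : ∃ T : H →L[ℂ] H, T.IsPositive ∧ IsCompactOperator T ∧
    ∀ ξ, ∃ (h : T (T ξ) ∈ D.domain) (h' : D ⟨T (T ξ), h⟩ ∈ D.domain),
      T (T ξ) + D ⟨D ⟨T (T ξ), h⟩, h'⟩ = ξ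
  domain_invariant : ∀ a ∈ 𝒜, ∀ ξ ∈ D.domain, π a ξ ∈ D.domain
  bounded_commutator : ∀ a ∈ 𝒜, ∃ C : H →L[ℂ] H, ∀ (ξ : H) (hξ : ξ ∈ D.domain)
    (ha : π a ξ ∈ D.domain), C ξ = D ⟨π a ξ, ha⟩ - π a (D ⟨ξ, hξ⟩)

/-- `χ` is a grading operator, i.e. a self-adjoint `χ` with `χ² = 1` (equivalently, a unitary
involution), which makes the triple even. -/
structure IsGrading {A : Type*} [CStarAlgebra A] (π : A →⋆ₐ[ℂ] (H →L[ℂ] H)) (D : H →ₗ.[ℂ] H)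
    (χ : H ≃ₗᵢ[ℂ] H) : Prop where
  involutive : ∀ ξ, χ (χ ξ) = ξ
  commutes : ∀ a ξ, π a (χ ξ) = χ (π a ξ)
  domain : ∀ ξ ∈ D.domain, χ ξ ∈ D.domain
  anticommutes : ∀ (ξ : H) (hξ : ξ ∈ D.domain) (h : χ ξ ∈ D.domain),
    D ⟨χ ξ, h⟩ = -χ (D ⟨ξ, hξ⟩)

/-- The triple is `G`-invariant by means of the unitary representation `u`. -/
structure IsInvariantTriple {A : Type*} [CStarAlgebra A] {G : Type*} [Group G]
    (α : G →* (A ≃⋆ₐ[ℂ] A)) (π : A →⋆ₐ[ℂ] (H →L[ℂ] H)) (D : H →ₗ.[ℂ] H)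
    (u : G →* (H ≃ₗᵢ[ℂ] H)) : Prop where
  covariant : ∀ g a ξ, π (α g a) ξ = u g (π a ((u g).symm ξ))
  domain : ∀ g, ∀ ξ ∈ D.domain, u g ξ ∈ D.domain
  commutes : ∀ (g : G) (ξ : H) (hξ : ξ ∈ D.domain) (h : u g ξ ∈ D.domain),
    D ⟨u g ξ, h⟩ = u g (D ⟨ξ, hξ⟩)

end Triples

/-! ### The triple on the crossed product

`Ĥ = H ⊗ ℓ²(G) ⊗ ℂ^κ`, where `κ = Fin 2` if the triple on `A` is odd and `κ = Unit`
(so that `Ĥ = H ⊗ ℓ²(G)`) if it is even. -/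

section Hat

variable {G : Type*} [Group G] {κ : Type*}
  {H : Type*} [NormedAddCommGroup H] [InnerProductSpace ℂ H]

variable (κ) in
/-- `Γ̂_h (ξ ⊗ δ_g) = u_h ξ ⊗ δ_{hg}`, diagonally in `ℂ^κ`. -/
def hatGamma (u : G →* (H ≃ₗᵢ[ℂ] H)) (h : G) : Ell2 (G × κ) H →L[ℂ] Ell2 (G × κ) H :=
  (lpTwist ((Equiv.mulLeft h⁻¹).prodCongr (Equiv.refl κ)) (fun _ => u h) :
    Ell2 (G × κ) H ≃ₗᵢ[ℂ] Ell2 (G × κ) H).toContinuousLinearEquiv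

section Algebra

variable [CompleteSpace H] {A : Type*} [CStarAlgebra A]

variable (κ) in
/-- `(π̂₂ ⋊ Γ̂)(a δ_h) = π̂₂(a) Γ̂_h`, where `π̂₂(a)(ξ ⊗ δ_g) = π(a) ξ ⊗ δ_g`. -/
def hatRep (π : A →⋆ₐ[ℂ] (H →L[ℂ] H)) (u : G →* (H ≃ₗᵢ[ℂ] H)) (a : A) (h : G) :
    Ell2 (G × κ) H →L[ℂ] Ell2 (G × κ) H :=
  fibrewise (G × κ) (π a) ∘L hatGamma κ u h

variable (κ) in
/-- The reduced crossed product `A ⋊_{α,r} G` in its representation `π̂₂ ⋊ Γ̂` on `Ĥ`: the norm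
closure of the *-algebra of the operators `(π̂₂ ⋊ Γ̂)(a δ_h)`. (The unitary
`ξ ⊗ δ_g ↦ u_g ξ ⊗ δ_g` conjugates the regular representation into `π̂₂ ⋊ Γ̂`.) -/
def crossedProduct (π : A →⋆ₐ[ℂ] (H →L[ℂ] H)) (u : G →* (H ≃ₗᵢ[ℂ] H)) :
    StarSubalgebra ℂ (Ell2 (G × κ) H →L[ℂ] Ell2 (G × κ) H) :=
  (StarAlgebra.adjoin ℂ {T | ∃ a h, T = hatRep κ π u a h}).topologicalClosure

theorem hatRep_mem (π : A →⋆ₐ[ℂ] (H →L[ℂ] H)) (u : G →* (H ≃ₗᵢ[ℂ] H)) (a : A) (h : G) :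
    hatRep κ π u a h ∈ crossedProduct κ π u :=
  StarSubalgebra.le_topologicalClosure _ (StarAlgebra.subset_adjoin ℂ _ ⟨a, h, rfl⟩)

/-- `1 ⊗ λ_h` on `(E ⊗ ℓ²(I)) ⊗ ℓ²(G)`. -/
def oneTensorLeftRegular (I : Type*) (E : Type*) [NormedAddCommGroup E] [InnerProductSpace ℂ E]
    (h : G) : Ell2 (I × G) E →L[ℂ] Ell2 (I × G) E :=
  (lpTwist ((Equiv.refl I).prodCongr (Equiv.mulLeft h⁻¹))
    (fun _ => LinearIsometryEquiv.refl ℂ E) :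
      Ell2 (I × G) E ≃ₗᵢ[ℂ] Ell2 (I × G) E).toContinuousLinearEquiv

/-- `θ` is the dual coaction of `G`: the *-homomorphism on `A ⋊_{α,r} G` with
`a δ_h ↦ a δ_h ⊗ δ_h`. -/
def IsDualCoaction (π : A →⋆ₐ[ℂ] (H →L[ℂ] H)) (u : G →* (H ≃ₗᵢ[ℂ] H))
    (θ : crossedProduct κ π u →⋆ₐ[ℂ]
      (Ell2 ((G × κ) × G) H →L[ℂ] Ell2 ((G × κ) × G) H)) : Prop :=
  ∀ a h, θ ⟨hatRep κ π u a h, hatRep_mem π u a h⟩ =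
    ampl G (hatRep κ π u a h) ∘L oneTensorLeftRegular (G × κ) H h

end Algebra

variable (G κ H) in
/-- The unitary `U (ξ ⊗ δ_x ⊗ δ_g) = ξ ⊗ δ_x ⊗ δ_{xg}`, diagonally in `ℂ^κ`. -/
def dualCorep : Ell2 ((G × κ) × G) H ≃ₗᵢ[ℂ] Ell2 ((G × κ) × G) H :=
  lpTwist
    { toFun := fun q => (q.1, q.1.1⁻¹ * q.2)
      invFun := fun q => (q.1, q.1.1 * q.2)
      left_inv := fun q => by ext <;> simp
      right_inv := fun q => by ext <;> simp }
    (fun _ => LinearIsometryEquiv.refl ℂ H)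

/-- The operator `(D̂ x)(i) = D (x (p i)) + c i (x (p i))` on its maximal domain. -/
def fibreDirac {I : Type*} (D : H →ₗ.[ℂ] H) (p : Equiv.Perm I) (c : I → H →L[ℂ] H) :
    Ell2 I H →ₗ.[ℂ] Ell2 I H where
  domain :=
    { carrier := {x | ∃ h : ∀ i, x (p i) ∈ D.domain,
        Memℓp (fun i => D ⟨x (p i), h i⟩ + c i (x (p i))) 2}
      zero_mem' := by
        refine ⟨fun i => D.domain.zero_mem, ?_⟩
        have h0 : (fun i => D ⟨(0 : Ell2 I H) (p i), D.domain.zero_mem⟩ +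
            c i ((0 : Ell2 I H) (p i))) = (0 : I → H) := by
          funext i
          change D (0 : D.domain) + c i 0 = 0
          simp
        rw [h0]
        exact zero_memℓp
      add_mem' := by
        rintro x y ⟨hx, mx⟩ ⟨hy, my⟩
        refine ⟨fun i => D.domain.add_mem (hx i) (hy i), ?_⟩
        have h0 := mx.add my
        convert h0 using 1
        funext i
        change D (⟨x (p i), hx i⟩ + ⟨y (p i), hy i⟩) + c i (x (p i) + y (p i)) =
          (D ⟨x (p i), hx i⟩ + c i (x (p i))) + (D ⟨y (p i), hy i⟩ + c i (y (p i)))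
        rw [D.map_add, map_add]
        abel
      smul_mem' := by
        rintro k x ⟨hx, mx⟩
        refine ⟨fun i => D.domain.smul_mem k (hx i), ?_⟩
        have h0 := mx.const_smul k
        convert h0 using 1
        funext i
        change D (k • ⟨x (p i), hx i⟩) + c i (k • x (p i)) =
          k • (D ⟨x (p i), hx i⟩ + c i (x (p i)))
        rw [D.map_smul, map_smul, smul_add] }
  toFun :=
    { toFun := fun x => ⟨fun i => D ⟨(x : Ell2 I H) (p i), x.2.1 i⟩ + c i ((x : Ell2 I H) (p i)),
        x.2.2⟩
      map_add' := fun x y => by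
        ext i
        obtain ⟨x, hx, mx⟩ := x
        obtain ⟨y, hy, my⟩ := y
        change D (⟨x (p i), hx i⟩ + ⟨y (p i), hy i⟩) + c i (x (p i) + y (p i)) =
          (D ⟨x (p i), hx i⟩ + c i (x (p i))) + (D ⟨y (p i), hy i⟩ + c i (y (p i)))
        rw [D.map_add, map_add]
        abel
      map_smul' := fun k x => by
        ext i
        obtain ⟨x, hx, mx⟩ := x
        change D (k • ⟨x (p i), hx i⟩) + c i (k • x (p i)) =
          k • (D ⟨x (p i), hx i⟩ + c i (x (p i)))
        rw [D.map_smul, map_smul, smul_add] }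

/-- The Dirac operator for an odd triple on `A`,
`D̂ = [[0, D ⊗ 1 - i ⊗ M_l], [D ⊗ 1 + i ⊗ M_l, 0]]` on `H ⊗ ℓ²(G) ⊗ ℂ²`. -/
def hatDiracOdd (D : H →ₗ.[ℂ] H) (l : G → ℝ) : Ell2 (G × Fin 2) H →ₗ.[ℂ] Ell2 (G × Fin 2) H :=
  fibreDirac D ((Equiv.refl G).prodCongr (Equiv.swap 0 1))
    (fun q => ((![-Complex.I, Complex.I] q.2) * (l q.1 : ℂ)) • ContinuousLinearMap.id ℂ H)

/-- The grading operator `σ₃` on `H ⊗ ℓ²(G) ⊗ ℂ²`. -/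
def hatGradingOdd : Ell2 (G × Fin 2) H ≃ₗᵢ[ℂ] Ell2 (G × Fin 2) H :=
  lpTwist (Equiv.refl (G × Fin 2))
    (fun q => (![LinearIsometryEquiv.refl ℂ H, LinearIsometryEquiv.neg ℂ] :
      Fin 2 → H ≃ₗᵢ[ℂ] H) q.2)

/-- The Dirac operator for an even triple on `A`, `D̂ = D ⊗ 1 + χ ⊗ M_l` on `H ⊗ ℓ²(G)`; in the
decomposition `H = H₀ ⊕ H₁` it is `[[1 ⊗ M_l, D₀ ⊗ 1], [D₀* ⊗ 1, -1 ⊗ M_l]]`. -/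
def hatDiracEven (D : H →ₗ.[ℂ] H) (χ : H ≃ₗᵢ[ℂ] H) (l : G → ℝ) :
    Ell2 (G × Unit) H →ₗ.[ℂ] Ell2 (G × Unit) H :=
  fibreDirac D (Equiv.refl _)
    (fun q => (l q.1 : ℂ) • (χ.toContinuousLinearEquiv : H →L[ℂ] H))

/-- The antiunitary `ξ ⊗ δ_g ⊗ e_{s k} ↦ u_g* (m k ξ) ⊗ δ_{g⁻¹} ⊗ e_k` for a permutation `s` of
the basis of `ℂ^κ` and antiunitaries `m k` of `H`. -/
def twistedFlip (u : G →* (H ≃ₗᵢ[ℂ] H)) (s : Equiv.Perm κ)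
    (m : κ → H ≃ₛₗᵢ[starRingEnd ℂ] H) :
    Ell2 (G × κ) H ≃ₛₗᵢ[starRingEnd ℂ] Ell2 (G × κ) H :=
  lpTwist ((Equiv.inv G).prodCongr s) (fun q => (m q.2).trans (u q.1))

/-- The scalar `i` as an element of the unitary group of `ℂ`. -/
def unitI : unitary ℂ := ⟨Complex.I, by simp [Unitary.mem_iff]⟩

/-- `Ĵ` for an odd triple of KO-dimension `n`, in terms of
`j (ξ ⊗ δ_g) = u_g* J ξ ⊗ δ_{g⁻¹}`: it is `j ⊗ cc` for `n = 3, 7` and `j ⊗ (cc ∘ σ₂)` for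
`n = 1, 5`, where `σ₂ (z₀, z₁) = (-i z₁, i z₀)`. -/
def hatRealOdd (u : G →* (H ≃ₗᵢ[ℂ] H)) (n : ZMod 8) (J : H ≃ₛₗᵢ[starRingEnd ℂ] H) :
    Ell2 (G × Fin 2) H ≃ₛₗᵢ[starRingEnd ℂ] Ell2 (G × Fin 2) H :=
  if n = 3 ∨ n = 7 then twistedFlip u (Equiv.refl _) (fun _ => J)
  else twistedFlip u (Equiv.swap 0 1)
    (fun k => ((![unitI⁻¹, unitI] k) • LinearIsometryEquiv.refl ℂ H).trans J)

/-- `Ĵ` for an even triple of KO-dimension `n`: it is `(χ ⊗ 1) j` for `n = 0, 4` and `j` for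
`n = 2, 6`. -/
def hatRealEven (u : G →* (H ≃ₗᵢ[ℂ] H)) (χ : H ≃ₗᵢ[ℂ] H) (n : ZMod 8)
    (J : H ≃ₛₗᵢ[starRingEnd ℂ] H) :
    Ell2 (G × Unit) H ≃ₛₗᵢ[starRingEnd ℂ] Ell2 (G × Unit) H :=
  if n = 0 ∨ n = 4 then twistedFlip u (Equiv.refl _) (fun _ => J.trans χ)
  else twistedFlip u (Equiv.refl _) (fun _ => J)

/-- The untwisted antiunitary `χJ ⊗ J_G` (for `n = 0, 4`), respectively `J ⊗ J_G` (for
`n = 2, 6`), where `J_G δ_g = δ_{g⁻¹}`. -/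
def untwistedRealEven (χ : H ≃ₗᵢ[ℂ] H) (n : ZMod 8) (J : H ≃ₛₗᵢ[starRingEnd ℂ] H) :
    Ell2 (G × Unit) H ≃ₛₗᵢ[starRingEnd ℂ] Ell2 (G × Unit) H :=
  hatRealEven (1 : G →* (H ≃ₗᵢ[ℂ] H)) χ n J

end Hat

end CrossedTriple

end

open scoped ENNReal InnerProductSpace ComplexOrder

namespace CrossedTriple

/-! ### Elementary tensors, amplifications and slices on `Ĥ ⊗ ℓ²(G)` -/

section Module

variable {I : Type*} {E : Type*} [NormedAddCommGroup E]

/-! Everything is computed in the fibres over the basis vectors `δ_x`. There `U` is diagonal: `U(v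
δ_x ⊗ b) = v δ_x ⊗ λ_x b` (`IsDiagonal`). A vector is the norm convergent sum of its fibre
components and `ξ ↦ ξ ⊗ b` is bounded, so a closed condition on `U` need only be checked on the
tensors `v δ_x ⊗ b`. On these, `U` commutes with `D̂ ⊗ 1` and `χ̂ ⊗ 1` because neither operator
changes `x`. The relation `(Ĵ ⊗ *)U = U(Ĵ ⊗ 1)` holds because `Ĵ` carries the fibre over `x` to that
over `x⁻¹`, and `λ_x* = λ_{x⁻¹}` (`IsDiagonal.intertwines`). How `Ĵ` acts inside the fibres is
irrelevant here, so the untwisted maps intertwine as well.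

The dual coaction is `b ↦ U(b ⊗ 1)U*`, since this sends `a δ_h` to `a δ_h ⊗ λ_h`
(`conjAmpl_hatRep`); covariance is then automatic. Slicing by `φ` gives `φ(λ_h) a δ_h` on the
generators, and a norm bound carries this to the whole crossed product (`exists_slice`).

For the real structure, `Ĵ (a δ_h) Ĵ⁻¹` is the right translation by `h` followed by `J π(α_g(a))
J⁻¹` in the fibre over `g`. Right translations commute with left ones and `J` commutes with `u`, so
the zeroth order condition reduces to the one for `J` (`twistedFlip_isRealStructure`). The sign
changes from `n` to `n + 1` come from `l(g⁻¹) = -l(g)`, the phases `±i` of `σ₂`, and the sign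
relating `χ` and `J`. -/

theorem hasSum_single [DecidableEq I] (x : Ell2 I E) :
    HasSum (fun i => lp.single 2 i (x i) : I → Ell2 I E) x :=
  lp.hasSum_single (by norm_num) x

theorem single_apply_ite [DecidableEq I] (i j : I) (v : E) :
    (lp.single 2 i v : Ell2 I E) j = if j = i then v else 0 := by
  rw [lp.single_apply, Pi.single_apply]

variable [InnerProductSpace ℂ E] {G : Type*}

theorem norm_tensorLeft_apply_le (ξ : Ell2 I E) (v : Ell2 G ℂ) :
    ‖tensorLeft G ξ v‖ ≤ ‖ξ‖ * ‖v‖ := by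
  have h : ‖tensorLeft G ξ v‖ =
      ‖fibrewise G (ContinuousLinearMap.toSpanSingleton ℂ ξ) v‖ :=
    (curryEll2 I G E).symm.norm_map _
  rw [h]
  refine (ContinuousLinearMap.le_opNorm _ v).trans ?_
  gcongr
  refine (LinearMap.mkContinuous_norm_le _ (norm_nonneg _) _).trans ?_
  rw [ContinuousLinearMap.norm_toSpanSingleton]

theorem norm_tensorLeft_le (ξ : Ell2 I E) : ‖tensorLeft G ξ‖ ≤ ‖ξ‖ :=
  ContinuousLinearMap.opNorm_le_bound (tensorLeft G ξ) (norm_nonneg ξ) (norm_tensorLeft_apply_le ξ)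

variable (G I E) in
/-- The bounded linear map `ξ ↦ ξ ⊗ 1`. -/
noncomputable def tensorLeftL : Ell2 I E →L[ℂ] Ell2 G ℂ →L[ℂ] Ell2 (I × G) E :=
  LinearMap.mkContinuous (E := Ell2 I E) (F := Ell2 G ℂ →L[ℂ] Ell2 (I × G) E)
    { toFun := fun ξ => tensorLeft G ξ
      map_add' := fun ξ η => by
        ext v ⟨i, g⟩
        exact smul_add (v g) (ξ i) (η i)
      map_smul' := fun c ξ => by
        ext v ⟨i, g⟩
        exact smul_comm (v g) c (ξ i) } 1
    fun ξ => (norm_tensorLeft_le ξ).trans_eq (one_mul _).symm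

theorem hasSum_tensorLeft {ι : Type*} {f : ι → Ell2 I E} {ξ : Ell2 I E} (h : HasSum f ξ) :
    HasSum (fun i => tensorLeft G (f i)) (tensorLeft G ξ) :=
  (tensorLeftL I E G).hasSum h

theorem hasSum_tensorLeft_comp {ι : Type*} {f : ι → Ell2 I E} {ξ : Ell2 I E} (h : HasSum f ξ)
    (b : Ell2 G ℂ →L[ℂ] Ell2 G ℂ) :
    HasSum (fun i => tensorLeft G (f i) ∘L b) (tensorLeft G ξ ∘L b) :=
  ((ContinuousLinearMap.compL ℂ (Ell2 G ℂ) (Ell2 G ℂ) (Ell2 (I × G) E)).flip b).hasSum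
    (hasSum_tensorLeft h)

/-- `act X` as a bounded linear map. -/
noncomputable def actL (X : Ell2 (I × G) E ≃ₗᵢ[ℂ] Ell2 (I × G) E) :
    (Ell2 G ℂ →L[ℂ] Ell2 (I × G) E) →L[ℂ] (Ell2 G ℂ →L[ℂ] Ell2 (I × G) E) :=
  ContinuousLinearMap.compL ℂ (Ell2 G ℂ) (Ell2 (I × G) E) (Ell2 (I × G) E)
    (X.toContinuousLinearEquiv : Ell2 (I × G) E →L[ℂ] Ell2 (I × G) E)

@[simp]
theorem actL_apply (X : Ell2 (I × G) E ≃ₗᵢ[ℂ] Ell2 (I × G) E)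
    (z : Ell2 G ℂ →L[ℂ] Ell2 (I × G) E) : actL X z = act X z := rfl

@[simp]
theorem act_apply (X : Ell2 (I × G) E ≃ₗᵢ[ℂ] Ell2 (I × G) E)
    (z : Ell2 G ℂ →L[ℂ] Ell2 (I × G) E) (v : Ell2 G ℂ) : act X z v = X (z v) := rfl

@[simp]
theorem act_symm_act (X : Ell2 (I × G) E ≃ₗᵢ[ℂ] Ell2 (I × G) E)
    (z : Ell2 G ℂ →L[ℂ] Ell2 (I × G) E) : act X.symm (act X z) = z := by
  ext v : 1
  simp

@[simp]
theorem sliceEll2_apply {J : Type*} (y : Ell2 (I × J) E) (g : J) (i : I) :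
    sliceEll2 y g i = y (i, g) := rfl

theorem slice_ampl {J : Type*} (T : Ell2 I E →L[ℂ] Ell2 I E) (y : Ell2 (I × J) E) (g : J) :
    sliceEll2 (ampl J T y) g = T (sliceEll2 y g) := rfl

theorem slice_tensorLeft {J : Type*} (ξ : Ell2 I E) (v : Ell2 J ℂ) (g : J) :
    sliceEll2 (tensorLeft J ξ v) g = v g • ξ := rfl

theorem ext_slice {J : Type*} {x y : Ell2 (I × J) E} (h : ∀ g, sliceEll2 x g = sliceEll2 y g) :
    x = y := by
  ext ⟨i, g⟩
  rw [← sliceEll2_apply, h, sliceEll2_apply]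

theorem inner_eq_tsum_slice {J : Type*} (x y : Ell2 (I × J) E) :
    ⟪x, y⟫_ℂ = ∑' g, ⟪sliceEll2 x g, sliceEll2 y g⟫_ℂ := by
  rw [← (curryEll2 I J E).inner_map_map]
  exact lp.inner_eq_tsum _ _

theorem norm_ampl_le {J : Type*} (T : Ell2 I E →L[ℂ] Ell2 I E) : ‖ampl J T‖ ≤ ‖T‖ := by
  refine ContinuousLinearMap.opNorm_le_bound _ (norm_nonneg T) fun x => ?_
  have h : ‖ampl J T x‖ = ‖fibrewise J T (curryEll2 I J E x)‖ :=
    (curryEll2 I J E).symm.norm_map _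
  rw [h]
  refine (ContinuousLinearMap.le_of_opNorm_le _
    (LinearMap.mkContinuous_norm_le _ (norm_nonneg _) _) _).trans ?_
  rw [LinearIsometryEquiv.norm_map]

section Ampl

variable [CompleteSpace E]

theorem star_ampl {J : Type*} (T : Ell2 I E →L[ℂ] Ell2 I E) :
    star (ampl J T) = ampl J (star T) := by
  symm
  refine (ContinuousLinearMap.eq_adjoint_iff _ _).2 fun x y => ?_
  simp only [inner_eq_tsum_slice, slice_ampl, ContinuousLinearMap.star_eq_adjoint,
    ContinuousLinearMap.adjoint_inner_left]

/-- The *-homomorphism `T ↦ X (T ⊗ 1) X*`. -/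
noncomputable def conjAmpl (X : Ell2 (I × G) E ≃ₗᵢ[ℂ] Ell2 (I × G) E) :
    (Ell2 I E →L[ℂ] Ell2 I E) →⋆ₐ[ℂ] (Ell2 (I × G) E →L[ℂ] Ell2 (I × G) E) where
  toFun T := (X.toContinuousLinearEquiv : Ell2 (I × G) E →L[ℂ] Ell2 (I × G) E) ∘L ampl G T ∘L
    (X.symm.toContinuousLinearEquiv : Ell2 (I × G) E →L[ℂ] Ell2 (I × G) E)
  map_one' := by
    ext x : 1
    exact X.apply_symm_apply x
  map_mul' S T := by
    ext x : 1
    change X (ampl G S (ampl G T (X.symm x))) = X (ampl G S (X.symm (X (ampl G T (X.symm x)))))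
    rw [X.symm_apply_apply]
  map_zero' := by
    ext x : 1
    exact map_zero X
  map_add' S T := by
    ext x : 1
    exact map_add X (ampl G S (X.symm x)) (ampl G T (X.symm x))
  commutes' c := by
    ext x : 1
    change X (c • X.symm x) = c • x
    rw [map_smul, X.apply_symm_apply]
  map_star' T := by
    refine (ContinuousLinearMap.eq_adjoint_iff _ _).2 fun x y => ?_
    change ⟪X (ampl G (star T) (X.symm x)), y⟫_ℂ = ⟪x, X (ampl G T (X.symm y))⟫_ℂ
    rw [← star_ampl, ← X.symm.inner_map_map, ← X.symm.inner_map_map x, X.symm_apply_apply,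
      X.symm_apply_apply, ContinuousLinearMap.star_eq_adjoint,
      ContinuousLinearMap.adjoint_inner_left]

theorem conjAmpl_apply (X : Ell2 (I × G) E ≃ₗᵢ[ℂ] Ell2 (I × G) E) (T : Ell2 I E →L[ℂ] Ell2 I E)
    (y : Ell2 (I × G) E) : conjAmpl X T y = X (ampl G T (X.symm y)) := rfl

theorem norm_conjAmpl_le (X : Ell2 (I × G) E ≃ₗᵢ[ℂ] Ell2 (I × G) E)
    (T : Ell2 I E →L[ℂ] Ell2 I E) : ‖conjAmpl X T‖ ≤ ‖T‖ := by
  refine ContinuousLinearMap.opNorm_le_bound _ (norm_nonneg T) fun x => ?_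
  rw [conjAmpl_apply, X.norm_map]
  refine (ContinuousLinearMap.le_of_opNorm_le _ (norm_ampl_le T) _).trans ?_
  rw [X.symm.norm_map]

/-- Covariance costs nothing for a coaction implemented by `X`: in `X (T ⊗ 1) X* X (ξ ⊗ 1)` the
middle factors cancel. -/
theorem corepMap_apply_eq (X : Ell2 (I × G) E ≃ₗᵢ[ℂ] Ell2 (I × G) E)
    (T : Ell2 I E →L[ℂ] Ell2 I E) (ξ : Ell2 I E) :
    corepMap X (T ξ) = conjAmpl X T ∘L corepMap X ξ := by
  ext v : 1
  change X (tensorLeft G (T ξ) v) = X (ampl G T (X.symm (X (tensorLeft G ξ v))))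
  rw [X.symm_apply_apply]
  congr 1
  refine ext_slice fun g => ?_
  rw [slice_ampl, slice_tensorLeft, slice_tensorLeft, map_smul]

/-- `b ↦ (ξ* ⊗ 1) X (b ⊗ 1) X* (η ⊗ 1)` as a bounded linear map. -/
noncomputable def sliceL (X : Ell2 (I × G) E ≃ₗᵢ[ℂ] Ell2 (I × G) E) (ξ η : Ell2 I E) :
    (Ell2 I E →L[ℂ] Ell2 I E) →L[ℂ] (Ell2 G ℂ →L[ℂ] Ell2 G ℂ) :=
  ContinuousLinearMap.compL ℂ (Ell2 G ℂ) (Ell2 (I × G) E) (Ell2 G ℂ)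
    (ContinuousLinearMap.adjoint (tensorLeft G ξ)) ∘L
  (ContinuousLinearMap.compL ℂ (Ell2 G ℂ) (Ell2 (I × G) E) (Ell2 (I × G) E)).flip
    (tensorLeft G η) ∘L
  LinearMap.mkContinuous (conjAmpl X).toAlgHom.toLinearMap 1 fun T => by
    rw [one_mul]
    exact norm_conjAmpl_le X T

/-- Boundedness jointly in `ξ`, `η` and `T` is what later bounds the sliced operator by the norm of
`T`. -/
theorem norm_sliceL_le (X : Ell2 (I × G) E ≃ₗᵢ[ℂ] Ell2 (I × G) E) (ξ η : Ell2 I E)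
    (T : Ell2 I E →L[ℂ] Ell2 I E) : ‖sliceL X ξ η T‖ ≤ ‖ξ‖ * (‖T‖ * ‖η‖) := by
  change ‖ContinuousLinearMap.adjoint (tensorLeft G ξ) ∘L (conjAmpl X T ∘L tensorLeft G η)‖ ≤ _
  refine (ContinuousLinearMap.opNorm_comp_le _ _).trans ?_
  rw [LinearIsometryEquiv.norm_map]
  refine mul_le_mul (norm_tensorLeft_le ξ) ((ContinuousLinearMap.opNorm_comp_le _ _).trans ?_) (norm_nonneg _)
    (norm_nonneg _)
  exact mul_le_mul (norm_conjAmpl_le X T) (norm_tensorLeft_le η) (norm_nonneg _) (norm_nonneg _)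

end Ampl

end Module

/-! ### The group algebra, closability of `J ⊗ *`, and diagonal unitaries -/

section Group

variable {G : Type*} [Group G] {I : Type*} {E : Type*} [NormedAddCommGroup E]

@[simp]
theorem leftRegular_apply (g : G) (v : Ell2 G ℂ) (h : G) : leftRegular g v h = v (g⁻¹ * h) := rfl

theorem leftRegular_mem (g : G) : leftRegular g ∈ reducedGroupAlgebra G :=
  StarSubalgebra.le_topologicalClosure _ (StarAlgebra.subset_adjoin ℂ _ ⟨g, rfl⟩)

theorem leftRegular_mul (g h : G) : leftRegular (g * h) = leftRegular g * leftRegular h := by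
  ext v k
  change v ((g * h)⁻¹ * k) = v (h⁻¹ * (g⁻¹ * k))
  rw [mul_inv_rev, mul_assoc]

theorem leftRegular_one : leftRegular (1 : G) = 1 := by
  ext v k
  change v (1⁻¹ * k) = v k
  simp

theorem star_leftRegular (g : G) : star (leftRegular g) = leftRegular g⁻¹ := by
  symm
  refine (ContinuousLinearMap.eq_adjoint_iff _ _).2 fun x y => ?_
  rw [lp.inner_eq_tsum, lp.inner_eq_tsum, ← (Equiv.mulLeft g⁻¹).tsum_eq]
  simp

omit [Group G] in
/-- The matrix coefficients of an element of `C*_r(G)` with respect to the canonical basis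
are those of its adjoint, transposed and conjugated. -/
theorem star_apply_single [DecidableEq G] (b : Ell2 G ℂ →L[ℂ] Ell2 G ℂ) (g h : G) :
    (star b) (lp.single 2 h 1) g = star (b (lp.single 2 g 1) h) := by
  have key (x : Ell2 G ℂ) (k : G) : ⟪(lp.single 2 k 1 : Ell2 G ℂ), x⟫_ℂ = x k := by
    rw [lp.inner_single_left]
    simp
  rw [← key, ContinuousLinearMap.star_eq_adjoint, ContinuousLinearMap.adjoint_inner_right,
    ← inner_conj_symm, key]
  rfl

variable [InnerProductSpace ℂ E]

/-- `J ⊗ *` is closable: the slices of `(J ⊗ *) z` are determined by those of `z`. -/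
theorem tensorStarGraph_slice [DecidableEq G] (J : Ell2 I E ≃ₛₗᵢ[starRingEnd ℂ] Ell2 I E)
    {z w : Ell2 G ℂ →L[ℂ] Ell2 (I × G) E} (h : (z, w) ∈ tensorStarGraph J) (g k : G) :
    sliceEll2 (w (lp.single 2 k 1)) g = J (sliceEll2 (z (lp.single 2 g 1)) k) := by
  have hc (v : Ell2 G ℂ) (g : G) :
      Continuous fun z : Ell2 G ℂ →L[ℂ] Ell2 (I × G) E => sliceEll2 (z v) g := by
    have h1 : Continuous fun y : Ell2 G (Ell2 I E) => y g :=
      (continuous_apply g).comp lp.uniformContinuous_coe.continuous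
    exact h1.comp ((curryEll2 I G E).continuous.comp (ContinuousLinearMap.apply ℂ _ v).continuous)
  -- The identity is closed and additive in the pair `(z, w)`, so it need only be checked on
  -- elementary tensors. There the adjoint transposes and conjugates the matrix coefficients of `b`,
  -- and the conjugation is absorbed by the antilinearity of `J`.
  let S : AddSubgroup ((Ell2 G ℂ →L[ℂ] Ell2 (I × G) E) × (Ell2 G ℂ →L[ℂ] Ell2 (I × G) E)) :=
    { carrier := {q | sliceEll2 (q.2 (lp.single 2 k 1)) g =
        J (sliceEll2 (q.1 (lp.single 2 g 1)) k)}
      zero_mem' := (map_zero J).symm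
      add_mem' := fun {p q} hp hq =>
        (congrArg₂ (· + ·) hp hq).trans (map_add J _ _).symm
      neg_mem' := fun {p} hp => (congrArg Neg.neg hp).trans (map_neg J _).symm }
  have hS : IsClosed (S : Set ((Ell2 G ℂ →L[ℂ] Ell2 (I × G) E) × (Ell2 G ℂ →L[ℂ] Ell2 (I × G) E))) :=
    isClosed_eq ((hc _ _).comp continuous_snd) (J.continuous.comp ((hc _ _).comp continuous_fst))
  refine closure_minimal (SetLike.coe_subset_coe.2 ((AddSubgroup.closure_le S).2 ?_)) hS h
  rintro _ ⟨ξ, b, -, rfl⟩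
  change sliceEll2 (tensorLeft G (J ξ) (star b (lp.single 2 k 1))) g =
    J (sliceEll2 (tensorLeft G ξ (b (lp.single 2 g 1))) k)
  rw [slice_tensorLeft, slice_tensorLeft, star_apply_single, J.map_smulₛₗ]
  rfl

/-- Although `J ⊗ *` may be unbounded, each slice of `w δ_k` is read off continuously from `z`, and
these slices determine `w`. -/
theorem tensorStarGraph_unique (J : Ell2 I E ≃ₛₗᵢ[starRingEnd ℂ] Ell2 I E)
    {z w w' : Ell2 G ℂ →L[ℂ] Ell2 (I × G) E} (h : (z, w) ∈ tensorStarGraph J)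
    (h' : (z, w') ∈ tensorStarGraph J) : w = w' := by
  classical
  ext v : 1
  have hs (k : G) : w (lp.single 2 k 1) = w' (lp.single 2 k 1) :=
    ext_slice fun g => by rw [tensorStarGraph_slice J h, tensorStarGraph_slice J h']
  have hs' (k : G) : w (lp.single 2 k (v k)) = w' (lp.single 2 k (v k)) := by
    have : (lp.single 2 k (v k) : Ell2 G ℂ) = v k • lp.single 2 k 1 := by
      rw [← lp.single_smul]
      simp
    rw [this, map_smul, map_smul, hs]
  refine (w.hasSum (hasSum_single v)).unique ?_
  simp only [hs']
  exact w'.hasSum (hasSum_single v)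

/-- A unitary `X` of `Ĥ ⊗ ℓ²(G)` with `X (v δ_i ⊗ b) = v δ_i ⊗ λ_{d i} b`. -/
def IsDiagonal [DecidableEq I] (d : I → G) (X : Ell2 (I × G) E ≃ₗᵢ[ℂ] Ell2 (I × G) E) : Prop :=
  ∀ i v, act X (tensorLeft G (lp.single 2 i v)) =
    tensorLeft G (lp.single 2 i v) ∘L leftRegular (d i)

theorem IsDiagonal.act_comp [DecidableEq I] {d : I → G}
    {X : Ell2 (I × G) E ≃ₗᵢ[ℂ] Ell2 (I × G) E} (hX : IsDiagonal d X) (i : I) (v : E)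
    (b : Ell2 G ℂ →L[ℂ] Ell2 G ℂ) :
    act X (tensorLeft G (lp.single 2 i v) ∘L b) =
      tensorLeft G (lp.single 2 i v) ∘L (leftRegular (d i) * b) :=
  congrArg (· ∘L b) (hX i v)

theorem IsDiagonal.symm [DecidableEq I] {d : I → G}
    {X : Ell2 (I × G) E ≃ₗᵢ[ℂ] Ell2 (I × G) E} (hX : IsDiagonal d X) :
    IsDiagonal (fun i => (d i)⁻¹) X.symm := fun i v => by
  have h := hX.act_comp i v (leftRegular (d i)⁻¹)
  rw [← leftRegular_mul, mul_inv_cancel, leftRegular_one] at h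
  rw [← act_symm_act X (tensorLeft G (lp.single 2 i v) ∘L leftRegular (d i)⁻¹), h]
  rfl

theorem IsDiagonal.act_mem [DecidableEq I] {d : I → G}
    {X : Ell2 (I × G) E ≃ₗᵢ[ℂ] Ell2 (I × G) E} (hX : IsDiagonal d X)
    {z : Ell2 G ℂ →L[ℂ] Ell2 (I × G) E} (hz : z ∈ hilbertModule G I E) :
    act X z ∈ hilbertModule G I E := by
  have hcl : IsClosed (hilbertModule G I E : Set (Ell2 G ℂ →L[ℂ] Ell2 (I × G) E)) := Submodule.isClosed_topologicalClosure _
  suffices h : hilbertModule G I E ≤ (hilbertModule G I E).comap (actL X).toLinearMap from h hz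
  refine Submodule.topologicalClosure_minimal _ (Submodule.span_le.2 ?_)
    (hcl.preimage (actL X).continuous)
  rintro _ ⟨ξ, b, hb, rfl⟩
  refine hcl.mem_of_tendsto ((actL X).hasSum (hasSum_tensorLeft_comp (hasSum_single ξ) b))
    (Filter.Eventually.of_forall fun F => Submodule.sum_mem _ fun i _ => ?_)
  rw [actL_apply, hX.act_comp]
  exact Submodule.le_topologicalClosure _
    (Submodule.subset_span ⟨_, _, mul_mem (leftRegular_mem _) hb, rfl⟩)

/-- `X` maps the graph of `D ⊗ 1` into itself, if the domain of `D` is exhausted by the sums of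
elements `v δ_i` which `D` maps to elements `w δ_j` with `d j = d i`. -/
theorem IsDiagonal.act_mem_tensorOneGraph [DecidableEq I] {d : I → G}
    {X : Ell2 (I × G) E ≃ₗᵢ[ℂ] Ell2 (I × G) E} (hX : IsDiagonal d X)
    {D : Ell2 I E →ₗ.[ℂ] Ell2 I E} (p : Equiv.Perm I) (hp : ∀ i, d (p i) = d i)
    (hD : ∀ (ξ : D.domain) (i : I), ∃ h : lp.single 2 (p i) ((ξ : Ell2 I E) (p i)) ∈ D.domain,
      D ⟨_, h⟩ = lp.single 2 i (D ξ i))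
    {z w : Ell2 G ℂ →L[ℂ] Ell2 (I × G) E} (h : (z, w) ∈ tensorOneGraph D) :
    (act X z, act X w) ∈ tensorOneGraph D := by
  unfold tensorOneGraph at h ⊢
  set M := Submodule.span ℂ {q | ∃ (ξ : D.domain) (b : Ell2 G ℂ →L[ℂ] Ell2 G ℂ),
    b ∈ reducedGroupAlgebra G ∧
      q = (tensorLeft G (ξ : Ell2 I E) ∘L b, tensorLeft G (D ξ) ∘L b)} with hM
  have hcl := M.isClosed_topologicalClosure
  let Φ := (actL X).prodMap (actL X)
  rw [← Submodule.topologicalClosure_coe] at h ⊢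
  suffices hle : M.topologicalClosure ≤ M.topologicalClosure.comap Φ.toLinearMap from hle h
  refine Submodule.topologicalClosure_minimal _ (Submodule.span_le.2 ?_)
    (hcl.preimage Φ.continuous)
  rintro _ ⟨ξ, b, hb, rfl⟩
  -- The expansion of `ξ` is reindexed by `p`, so that `D` maps its `i`-th term to the `i`-th term
  -- of the expansion of `D ξ`. The partial sums then lie in the graph and converge in both
  -- coordinates.
  have h1 : HasSum (fun i => lp.single 2 (p i) ((ξ : Ell2 I E) (p i)) : I → Ell2 I E) ξ :=
    p.hasSum_iff.2 (hasSum_single (ξ : Ell2 I E))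
  have h2 := hasSum_single (D ξ)
  refine hcl.mem_of_tendsto (Φ.hasSum ((hasSum_tensorLeft_comp h1 b).prodMk
    (hasSum_tensorLeft_comp h2 b)))
    (Filter.Eventually.of_forall fun F => Submodule.sum_mem _ fun i _ => ?_)
  obtain ⟨hi, hDi⟩ := hD ξ i
  change (act X (tensorLeft G (lp.single 2 (p i) ((ξ : Ell2 I E) (p i))) ∘L b),
    act X (tensorLeft G (lp.single 2 i (D ξ i)) ∘L b)) ∈ M.topologicalClosure
  -- As `d (p i) = d i`, both coordinates acquire the same factor `λ_{d i} b`, so the pair is again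
  -- a generator of the graph.
  rw [hX.act_comp, hX.act_comp, hp, ← hDi]
  exact Submodule.le_topologicalClosure _
    (Submodule.subset_span ⟨⟨_, hi⟩, _, mul_mem (leftRegular_mem _) hb, rfl⟩)

/-- `(J ⊗ *) X = X (J ⊗ 1)` on `Ĥ ⊗ 1`, if `J` maps `v δ_i` to some `w δ_j` with
`d j = (d i)⁻¹`. -/
theorem IsDiagonal.intertwines [DecidableEq I] {d : I → G}
    {X : Ell2 (I × G) E ≃ₗᵢ[ℂ] Ell2 (I × G) E} (hX : IsDiagonal d X)
    (J : Ell2 I E ≃ₛₗᵢ[starRingEnd ℂ] Ell2 I E)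
    (hJ : ∀ i v, ∃ j w, d j = (d i)⁻¹ ∧ J (lp.single 2 i v) = lp.single 2 j w) :
    Intertwines X J := by
  refine ⟨fun z w w' h h' => tensorStarGraph_unique J h h', fun ξ => ?_⟩
  have h1 := hasSum_single ξ
  have h2 : HasSum (fun i => J (lp.single 2 i (ξ i))) (J ξ) :=
    h1.map (J : Ell2 I E →+ Ell2 I E) J.continuous
  unfold tensorStarGraph
  rw [← AddSubgroup.topologicalClosure_coe]
  refine (AddSubgroup.isClosed_topologicalClosure _).mem_of_tendsto
    (((actL X).hasSum (hasSum_tensorLeft h1)).prodMk ((actL X).hasSum (hasSum_tensorLeft h2)))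
    (Filter.Eventually.of_forall fun F => sum_mem fun i _ => ?_)
  -- The generator is `v δ_i ⊗ λ_{d i}`; its image under `J ⊗ *` carries `λ_{d i}*`, which is the
  -- factor `λ_{d j}` that `X` produces on `J (v δ_i)`.
  refine AddSubgroup.le_topologicalClosure _
    (AddSubgroup.subset_closure ⟨_, leftRegular (d i), leftRegular_mem _, Prod.ext (hX _ _) ?_⟩)
  obtain ⟨j, w, hj, hw⟩ := hJ i (ξ i)
  change act X (tensorLeft G (J (lp.single 2 i (ξ i)))) = _
  rw [hw, hX, hj, star_leftRegular]

end Group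

section Slices

variable {I : Type*} {E : Type*} [NormedAddCommGroup E] [InnerProductSpace ℂ E] [CompleteSpace E]

/-- The module inner product of `ξ ⊗ 1` and `ζ ⊗ 1` is a scalar, which makes slices of the
generators explicit. -/
theorem adjoint_tensorLeft_comp (J : Type*) (ξ ζ : Ell2 I E) :
    ContinuousLinearMap.adjoint (tensorLeft J ξ) ∘L tensorLeft J ζ =
      ⟪ξ, ζ⟫_ℂ • ContinuousLinearMap.id ℂ (Ell2 J ℂ) := by
  ext v : 1
  refine ext_inner_left ℂ fun w => ?_
  simp only [ContinuousLinearMap.comp_apply, ContinuousLinearMap.adjoint_inner_right,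
    smul_apply, ContinuousLinearMap.id_apply, inner_smul_right]
  rw [inner_eq_tsum_slice, lp.inner_eq_tsum w v, ← tsum_mul_left]
  refine tsum_congr fun g => ?_
  rw [slice_tensorLeft, slice_tensorLeft, inner_smul_left, inner_smul_right]
  simp only [RCLike.inner_apply]
  ring

end Slices

/-! ### The dual corepresentation and the twisted flip -/

section Crossed

variable {G : Type*} [Group G] {κ : Type*}
  {H : Type*} [NormedAddCommGroup H] [InnerProductSpace ℂ H]

theorem map_inv_apply (u : G →* (H ≃ₗᵢ[ℂ] H)) (g : G) (ξ : H) : u g⁻¹ ξ = (u g).symm ξ := by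
  rw [map_inv]
  rfl

theorem map_mul_apply (u : G →* (H ≃ₗᵢ[ℂ] H)) (g h : G) (ξ : H) : u (g * h) ξ = u g (u h ξ) := by
  rw [map_mul]
  rfl

theorem dualCorep_isDiagonal [DecidableEq (G × κ)] :
    IsDiagonal (fun q : G × κ => q.1) (dualCorep G κ H) := by
  intro i v
  ext w ⟨j, g⟩
  change w (j.1⁻¹ * g) • (lp.single 2 i v : Ell2 (G × κ) H) j =
    w (i.1⁻¹ * g) • (lp.single 2 i v : Ell2 (G × κ) H) j
  rw [single_apply_ite]
  split_ifs with hj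
  · rw [hj]
  · simp

theorem dualCorep_isUnitaryCorep : IsUnitaryCorep (dualCorep G κ H) := by
  classical
  refine ⟨fun z => ⟨fun h => ?_, dualCorep_isDiagonal.act_mem⟩, fun y => ?_⟩
  · rw [← act_symm_act (dualCorep G κ H) z]
    exact dualCorep_isDiagonal.symm.act_mem h
  · ext ⟨⟨i, s⟩, t⟩
    change y ((i, i.1⁻¹ * s), (i.1⁻¹ * s) * (s⁻¹ * t)) = y ((i, i.1⁻¹ * s), i.1⁻¹ * t)
    rw [mul_assoc, mul_inv_cancel_left]

/-- Only the inversion of the `G`-coordinate matters; no compatibility between `u`, `s` and `m` is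
needed. -/
theorem twistedFlip_intertwines (u : G →* (H ≃ₗᵢ[ℂ] H)) (s : Equiv.Perm κ)
    (m : κ → H ≃ₛₗᵢ[starRingEnd ℂ] H) : Intertwines (dualCorep G κ H) (twistedFlip u s m) := by
  classical
  refine dualCorep_isDiagonal.intertwines _ fun i v =>
    ⟨(i.1⁻¹, s.symm i.2), u i.1⁻¹ (m (s.symm i.2) v), rfl, ?_⟩
  ext ⟨g, k⟩
  change u g (m k ((lp.single 2 i v : Ell2 (G × κ) H) (g⁻¹, s k))) = _
  rw [single_apply_ite, single_apply_ite]
  obtain ⟨x, k'⟩ := i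
  by_cases h : (g, k) = (x⁻¹, s.symm k')
  · obtain ⟨rfl, rfl⟩ := Prod.ext_iff.1 h
    simp
  · rw [if_neg h, if_neg, map_zero, map_zero]
    intro h'
    obtain ⟨rfl, rfl⟩ := Prod.ext_iff.1 h'
    simp at h

/-! ### Fibrewise Dirac operators -/

section Dirac

/-- `D̂` maps `v δ_{p i}` to `(D v + c_i v) δ_i`. -/
theorem fibreDirac_single {I : Type*} [DecidableEq I] (D : H →ₗ.[ℂ] H) (p : Equiv.Perm I)
    (c : I → H →L[ℂ] H) (ξ : (fibreDirac D p c).domain) (i : I) :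
    ∃ h : lp.single 2 (p i) ((ξ : Ell2 I H) (p i)) ∈ (fibreDirac D p c).domain,
      fibreDirac D p c ⟨_, h⟩ = lp.single 2 i (fibreDirac D p c ξ i) := by
  have hdom (j : I) : (lp.single 2 (p i) ((ξ : Ell2 I H) (p i)) : Ell2 I H) (p j) ∈ D.domain := by
    rw [single_apply_ite]
    split_ifs
    exacts [ξ.2.1 i, D.domain.zero_mem]
  have hval (j : I) : D ⟨_, hdom j⟩ +
      c j ((lp.single 2 (p i) ((ξ : Ell2 I H) (p i)) : Ell2 I H) (p j)) =
        (lp.single 2 i (fibreDirac D p c ξ i) : Ell2 I H) j := by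
    rw [single_apply_ite i j]
    by_cases hj : j = i
    · subst hj
      have he : (lp.single 2 (p j) ((ξ : Ell2 I H) (p j)) : Ell2 I H) (p j) =
          (ξ : Ell2 I H) (p j) := lp.single_apply_self ..
      rw [if_pos rfl]
      exact congrArg₂ (· + ·) (congrArg D (Subtype.ext he)) (congrArg (c j) he)
    · have he : (lp.single 2 (p i) ((ξ : Ell2 I H) (p i)) : Ell2 I H) (p j) = 0 := by
        rw [single_apply_ite, if_neg fun h => hj (p.injective h)]
      rw [if_neg hj]
      have he' : (⟨_, hdom j⟩ : D.domain) = 0 := Subtype.ext he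
      refine (congrArg₂ (· + ·) (congrArg D he') (congrArg (c j) he)).trans ?_
      rw [map_zero, add_zero]
      exact map_zero D.toFun
  have hmem : lp.single 2 (p i) ((ξ : Ell2 I H) (p i)) ∈ (fibreDirac D p c).domain := by
    refine ⟨hdom, ?_⟩
    rw [show (fun j => D ⟨_, hdom j⟩ +
      c j ((lp.single 2 (p i) ((ξ : Ell2 I H) (p i)) : Ell2 I H) (p j))) = _ from funext hval]
    exact lp.memℓp _
  exact ⟨hmem, lp.ext (funext hval)⟩

theorem dualCorep_tensorOneGraph (D : H →ₗ.[ℂ] H) (p : Equiv.Perm (G × κ))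
    (hp : ∀ q, (p q).1 = q.1) (c : G × κ → H →L[ℂ] H)
    (z w : Ell2 G ℂ →L[ℂ] Ell2 ((G × κ) × G) H) :
    (z, w) ∈ tensorOneGraph (fibreDirac D p c) ↔
      (act (dualCorep G κ H) z, act (dualCorep G κ H) w) ∈ tensorOneGraph (fibreDirac D p c) := by
  classical
  constructor
  · exact dualCorep_isDiagonal.act_mem_tensorOneGraph p hp (fibreDirac_single D p c)
  · intro h
    rw [← act_symm_act (dualCorep G κ H) z, ← act_symm_act (dualCorep G κ H) w]
    exact dualCorep_isDiagonal.symm.act_mem_tensorOneGraph p (fun q => congrArg _ (hp q))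
      (fibreDirac_single D p c) h

@[simp]
theorem twistedFlip_apply (u : G →* (H ≃ₗᵢ[ℂ] H)) (s : Equiv.Perm κ)
    (m : κ → H ≃ₛₗᵢ[starRingEnd ℂ] H) (x : Ell2 (G × κ) H) (g : G) (k : κ) :
    twistedFlip u s m x (g, k) = u g (m k (x (g⁻¹, s k))) := rfl

theorem twistedFlip_symm_apply (u : G →* (H ≃ₗᵢ[ℂ] H)) (s : Equiv.Perm κ)
    (m : κ → H ≃ₛₗᵢ[starRingEnd ℂ] H) (x : Ell2 (G × κ) H) (g : G) (k : κ) :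
    (twistedFlip u s m).symm x (g, k) =
      (m (s.symm k)).symm ((u g⁻¹).symm (x (g⁻¹, s.symm k))) := rfl

/-- `D̂ Ĵ = e Ĵ D̂` on the domain of `D̂`, from the corresponding relations in the fibres. -/
theorem fibreDirac_twistedFlip {D : H →ₗ.[ℂ] H} {u : G →* (H ≃ₗᵢ[ℂ] H)} {s τ : Equiv.Perm κ}
    {m : κ → H ≃ₛₗᵢ[starRingEnd ℂ] H} {p : Equiv.Perm (G × κ)} {c : G × κ → H →L[ℂ] H} {e : ℤ}
    (hud : ∀ g, ∀ ξ ∈ D.domain, u g ξ ∈ D.domain)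
    (huD : ∀ (g : G) (ξ : H) (hξ : ξ ∈ D.domain) (h : u g ξ ∈ D.domain),
      D ⟨u g ξ, h⟩ = u g (D ⟨ξ, hξ⟩))
    (huc : ∀ g q ξ, c q (u g ξ) = u g (c q ξ))
    (hp : ∀ g k, p (g, k) = (g, τ k)) (hs : ∀ k, s (τ k) = τ (s k))
    (hmd : ∀ k, ∀ ξ ∈ D.domain, m k ξ ∈ D.domain)
    (hmD : ∀ (k : κ) (ξ : H) (hξ : ξ ∈ D.domain) (h : m (τ k) ξ ∈ D.domain),
      D ⟨m (τ k) ξ, h⟩ = e • m k (D ⟨ξ, hξ⟩))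
    (hmc : ∀ g k ξ, c (g, k) (m (τ k) ξ) = e • m k (c (g⁻¹, s k) ξ))
    (x : (fibreDirac D p c).domain) :
    ∃ h : twistedFlip u s m x ∈ (fibreDirac D p c).domain,
      fibreDirac D p c ⟨_, h⟩ = e • twistedFlip u s m (fibreDirac D p c x) := by
  have hx (g : G) (k : κ) : (x : Ell2 (G × κ) H) (g, τ k) ∈ D.domain := hp g k ▸ x.2.1 (g, k)
  have hv (g : G) (k : κ) : fibreDirac D p c x (g, k) = D ⟨_, hx g k⟩ +
      c (g, k) ((x : Ell2 (G × κ) H) (g, τ k)) := by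
    have he : (x : Ell2 (G × κ) H) (p (g, k)) = (x : Ell2 (G × κ) H) (g, τ k) := by rw [hp]
    exact congrArg₂ (· + ·) (congrArg D (Subtype.ext he)) (congrArg (c (g, k)) he)
  have he (g : G) (k : κ) : twistedFlip u s m x (p (g, k)) =
      u g (m (τ k) ((x : Ell2 (G × κ) H) (g⁻¹, τ (s k)))) := by
    rw [hp, twistedFlip_apply, hs]
  have hdom (q : G × κ) : twistedFlip u s m x (p q) ∈ D.domain := by
    rw [he q.1 q.2]
    exact hud _ _ (hmd _ _ (hx _ _))
  have hval (q : G × κ) : D ⟨_, hdom q⟩ + c q (twistedFlip u s m x (p q)) =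
      (e • twistedFlip u s m (fibreDirac D p c x) : Ell2 (G × κ) H) q := by
    obtain ⟨g, k⟩ := q
    have h1 := hmd (τ k) _ (hx g⁻¹ (s k))
    have h2 : D ⟨_, hdom (g, k)⟩ = D ⟨_, hud g _ h1⟩ := congrArg D (Subtype.ext (he g k))
    rw [h2, he g k, huD _ _ h1, hmD k _ (hx g⁻¹ (s k)), huc, hmc, ← map_add, ← smul_add,
      ← map_add, ← hv, map_zsmul]
    rfl
  have hmem : twistedFlip u s m x ∈ (fibreDirac D p c).domain := by
    refine ⟨hdom, ?_⟩
    rw [show (fun q => D ⟨_, hdom q⟩ + c q (twistedFlip u s m x (p q))) = _ from funext hval]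
    exact lp.memℓp _
  exact ⟨hmem, lp.ext (funext hval)⟩

end Dirac

/-! ### The crossed product, its dual coaction and its real structure -/

section Algebra

variable [CompleteSpace H] {A : Type*} [CStarAlgebra A] {π : A →⋆ₐ[ℂ] (H →L[ℂ] H)}
  {u : G →* (H ≃ₗᵢ[ℂ] H)}

@[simp]
theorem hatRep_apply (a : A) (h : G) (x : Ell2 (G × κ) H) (g : G) (k : κ) :
    hatRep κ π u a h x (g, k) = π a (u h (x (h⁻¹ * g, k))) := rfl

theorem hatRep_one : hatRep κ π u 1 1 = 1 := by
  ext x ⟨g, k⟩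
  simp

theorem hatRep_mul {α : G →* (A ≃⋆ₐ[ℂ] A)}
    (hα : ∀ g a ξ, π (α g a) ξ = u g (π a ((u g).symm ξ))) (a b : A) (g h : G) :
    hatRep κ π u a g * hatRep κ π u b h = hatRep κ π u (a * α g b) (g * h) := by
  ext x ⟨t, k⟩
  change π a (u g (π b (u h (x (h⁻¹ * (g⁻¹ * t), k))))) =
    π (a * α g b) (u (g * h) (x ((g * h)⁻¹ * t, k)))
  rw [map_mul π, mul_apply_eq_comp, hα, map_mul_apply, mul_inv_rev, mul_assoc,
    LinearIsometryEquiv.symm_apply_apply]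

theorem star_hatRep {α : G →* (A ≃⋆ₐ[ℂ] A)}
    (hα : ∀ g a ξ, π (α g a) ξ = u g (π a ((u g).symm ξ))) (a : A) (h : G) :
    star (hatRep κ π u a h) = hatRep κ π u (α h⁻¹ (star a)) h⁻¹ := by
  symm
  refine (ContinuousLinearMap.eq_adjoint_iff _ _).2 fun x y => ?_
  rw [lp.inner_eq_tsum, lp.inner_eq_tsum,
    ← ((Equiv.mulLeft h⁻¹).prodCongr (Equiv.refl κ)).tsum_eq]
  refine tsum_congr fun ⟨g, k⟩ => ?_
  change ⟪π (α h⁻¹ (star a)) (u h⁻¹ (x (h⁻¹⁻¹ * (h⁻¹ * g), k))), y (h⁻¹ * g, k)⟫_ℂ =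
    ⟪x (g, k), π a (u h (y (h⁻¹ * g, k)))⟫_ℂ
  rw [hα, inv_inv, mul_inv_cancel_left, LinearIsometryEquiv.symm_apply_apply, map_inv_apply,
    ← (u h).inner_map_map, LinearIsometryEquiv.apply_symm_apply, map_star,
    ContinuousLinearMap.star_eq_adjoint, ContinuousLinearMap.adjoint_inner_left]

/-- A closed subspace which contains all `a δ_h` contains the crossed product. -/
theorem crossedProduct_subset {α : G →* (A ≃⋆ₐ[ℂ] A)}
    (hα : ∀ g a ξ, π (α g a) ξ = u g (π a ((u g).symm ξ)))
    (M : Submodule ℂ (Ell2 (G × κ) H →L[ℂ] Ell2 (G × κ) H))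
    (hM : IsClosed (M : Set (Ell2 (G × κ) H →L[ℂ] Ell2 (G × κ) H)))
    (h : ∀ a g, hatRep κ π u a g ∈ M) : ∀ T ∈ crossedProduct κ π u, T ∈ M := by
  -- By covariance the operators `a δ_h` already form a monoid stable under adjoints, so their
  -- linear span is the whole *-algebra they generate.
  let N : Submonoid (Ell2 (G × κ) H →L[ℂ] Ell2 (G × κ) H) :=
    { carrier := {T | ∃ a h, T = hatRep κ π u a h}
      one_mem' := ⟨1, 1, hatRep_one.symm⟩
      mul_mem' := by
        rintro _ _ ⟨a, g, rfl⟩ ⟨b, h, rfl⟩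
        exact ⟨_, _, hatRep_mul hα a b g h⟩ }
  intro T hT
  refine closure_minimal (fun T hT => ?_) hM hT
  have hT' : T ∈ Submodule.span ℂ (Submonoid.closure
      ({T | ∃ a h, T = hatRep κ π u a h} ∪ star {T | ∃ a h, T = hatRep κ π u a h}) :
        Set (Ell2 (G × κ) H →L[ℂ] Ell2 (G × κ) H)) := by
    rw [← StarAlgebra.adjoin_eq_span]
    exact hT
  refine Submodule.span_le.2 (fun S hS => ?_) hT'
  have hN : Submonoid.closure ({T | ∃ a h, T = hatRep κ π u a h} ∪
      star {T | ∃ a h, T = hatRep κ π u a h}) ≤ N := by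
    refine Submonoid.closure_le.2 (Set.union_subset (fun _ h => h) ?_)
    rintro S ⟨a, g, hS⟩
    exact ⟨_, _, (star_star S).symm.trans ((congrArg star hS).trans (star_hatRep hα a g))⟩
  obtain ⟨a, g, rfl⟩ := hN hS
  exact h a g

/-- `U*` shifts the last leg by `x⁻¹` and `U` then shifts it by `hx`, as `Γ̂_h` has moved `x` to
`hx`; the net shift is `h x x⁻¹ = h`, independent of `x`. -/
theorem conjAmpl_hatRep (a : A) (h : G) :
    conjAmpl (dualCorep G κ H) (hatRep κ π u a h) =
      ampl G (hatRep κ π u a h) ∘L oneTensorLeftRegular (G × κ) H h := by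
  ext y ⟨⟨x, k⟩, g⟩
  change π a (u h (y ((h⁻¹ * x, k), h⁻¹ * x * (x⁻¹ * g)))) =
    π a (u h (y ((h⁻¹ * x, k), h⁻¹ * g)))
  rw [mul_assoc, mul_inv_cancel_left]

theorem sliceL_hatRep (ξ η : Ell2 (G × κ) H) (a : A) (h : G) :
    sliceL (dualCorep G κ H) ξ η (hatRep κ π u a h) =
      ⟪ξ, hatRep κ π u a h η⟫_ℂ • leftRegular h := by
  have h1 : conjAmpl (dualCorep G κ H) (hatRep κ π u a h) ∘L tensorLeft G η =
      tensorLeft G (hatRep κ π u a h η) ∘L leftRegular h := by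
    rw [conjAmpl_hatRep]
    ext v : 1
    refine ext_slice fun g => ?_
    change hatRep κ π u a h (v (h⁻¹ * g) • η) = v (h⁻¹ * g) • hatRep κ π u a h η
    rw [map_smul]
  change ContinuousLinearMap.adjoint (tensorLeft G ξ) ∘L
    (conjAmpl (dualCorep G κ H) (hatRep κ π u a h) ∘L tensorLeft G η) = _
  rw [h1, ← ContinuousLinearMap.comp_assoc, adjoint_tensorLeft_comp]
  rfl

/-- The slice maps of `U (b ⊗ 1) U*` lie in the bicommutant. -/
theorem exists_slice {α : G →* (A ≃⋆ₐ[ℂ] A)}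
    (hα : ∀ g a ξ, π (α g a) ξ = u g (π a ((u g).symm ξ)))
    (φ : reducedGroupAlgebra G →L[ℂ] ℂ) (b : Ell2 (G × κ) H →L[ℂ] Ell2 (G × κ) H)
    (hb : b ∈ crossedProduct κ π u) :
    ∃ R ∈ Set.centralizer (Set.centralizer
        (crossedProduct κ π u : Set (Ell2 (G × κ) H →L[ℂ] Ell2 (G × κ) H))),
      ∀ ξ η : Ell2 (G × κ) H, ∃ c : reducedGroupAlgebra G,
        (c : Ell2 G ℂ →L[ℂ] Ell2 G ℂ) = sliceL (dualCorep G κ H) ξ η b ∧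
        ⟪ξ, R η⟫_ℂ = φ c := by
  -- A Hahn–Banach extension to all operators on `ℓ²(G)`, so that slices can be composed with the
  -- functional before they are known to lie in `C*_r(G)`.
  obtain ⟨ψ, hψ, -⟩ := exists_extension_norm_eq
    (reducedGroupAlgebra G).toSubalgebra.toSubmodule φ
  have hmem (ξ η : Ell2 (G × κ) H) :
      sliceL (dualCorep G κ H) ξ η b ∈ reducedGroupAlgebra G := by
    refine crossedProduct_subset hα
      ((reducedGroupAlgebra G).toSubalgebra.toSubmodule.comap
        (sliceL (dualCorep G κ H) ξ η).toLinearMap)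
      ((StarSubalgebra.isClosed_topologicalClosure _).preimage
        (sliceL (dualCorep G κ H) ξ η).continuous) (fun a g => ?_) b hb
    change sliceL (dualCorep G κ H) ξ η (hatRep κ π u a g) ∈ reducedGroupAlgebra G
    rw [sliceL_hatRep]
    exact SMulMemClass.smul_mem _ (leftRegular_mem g)
  let L := Ell2 (G × κ) H →L[ℂ] Ell2 (G × κ) H
  let B'' : Subalgebra ℂ L := Subalgebra.centralizer ℂ (Subalgebra.centralizer ℂ
    (crossedProduct κ π u : Set L) : Set L)
  -- The pairs `(b, R)` where `R` is in the bicommutant and is weakly the slice of `b`. The first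
  -- projection of `S` is to contain the crossed product; it contains the generators, so its
  -- closedness suffices.
  let S : Submodule ℂ (L × L) :=
    { carrier := {q | q.2 ∈ B'' ∧
        ∀ ξ η, ⟪ξ, q.2 η⟫_ℂ = ψ (sliceL (dualCorep G κ H) ξ η q.1)}
      zero_mem' := ⟨B''.zero_mem, fun ξ η => by simp⟩
      add_mem' := fun {p q} hp hq => ⟨B''.add_mem hp.1 hq.1, fun ξ η => by
        have h1 := hp.2 ξ η
        have h2 := hq.2 ξ η
        simp only [Prod.fst_add, Prod.snd_add, add_apply, inner_add_right,
          map_add, h1, h2]⟩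
      smul_mem' := fun c p hp => ⟨B''.smul_mem hp.1 c, fun ξ η => by
        have h1 := hp.2 ξ η
        simp only [Prod.smul_fst, Prod.smul_snd, smul_apply,
          inner_smul_right, map_smul, h1, smul_eq_mul]⟩ }
  have hS : IsClosed (S : Set (L × L)) := by
    have h1 : IsClosed (B'' : Set L) := Set.isClosed_centralizer _
    have h2 : (S : Set (L × L)) = Prod.snd ⁻¹' (B'' : Set L) ∩ ⋂ ξ, ⋂ η,
        {q | ⟪ξ, q.2 η⟫_ℂ = ψ (sliceL (dualCorep G κ H) ξ η q.1)} := by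
      ext q
      simp only [Set.mem_inter_iff, Set.mem_iInter]
      rfl
    rw [h2]
    refine (h1.preimage continuous_snd).inter
      (isClosed_iInter fun ξ => isClosed_iInter fun η => isClosed_eq ?_ ?_)
    · exact continuous_const.inner
        ((ContinuousLinearMap.apply ℂ _ η).continuous.comp continuous_snd)
    · exact ψ.continuous.comp ((sliceL _ ξ η).continuous.comp continuous_fst)
  -- Taking `ξ = R η` in the weak identity gives `‖R η‖² ≤ ‖ψ‖ ‖R η‖ ‖b‖ ‖η‖`.
  have hbound (q : S) : ‖q.1.2‖ ≤ ‖ψ‖ * ‖q.1.1‖ := by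
    refine ContinuousLinearMap.opNorm_le_bound _ (by positivity) fun η => ?_
    rcases (norm_nonneg (q.1.2 η)).eq_or_lt with h0 | h0
    · rw [← h0]
      positivity
    refine le_of_mul_le_mul_left ?_ h0
    have h1 : ‖q.1.2 η‖ * ‖q.1.2 η‖ = ‖⟪q.1.2 η, q.1.2 η⟫_ℂ‖ := by
      rw [inner_self_eq_norm_sq_to_K, norm_pow, RCLike.norm_ofReal, abs_norm, sq]
    rw [h1, q.2.2]
    refine (ψ.le_opNorm_of_le (norm_sliceL_le _ _ _ _)).trans_eq ?_
    ring
  have hcl : IsClosed (S.map (LinearMap.fst ℂ L L) : Set L) := by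
    have : CompleteSpace S := hS.completeSpace_coe
    have h1 : (S.map (LinearMap.fst ℂ L L) : Set L) =
        Set.range ((LinearMap.fst ℂ L L).comp S.subtype) := by
      ext
      simp
    rw [h1]
    -- On the complete space `S` the first projection is bounded below, hence has closed range. The
    -- constant accounts for both entries of the sup norm on pairs.
    refine AntilipschitzWith.isClosed_range (K := max 1 ‖ψ‖₊)
      (AddMonoidHomClass.antilipschitz_of_bound _ fun q => ?_)
      (uniformContinuous_fst.comp uniformContinuous_subtype_val)
    refine max_le ?_ ((hbound q).trans ?_)
    · exact le_mul_of_one_le_left (norm_nonneg _) (le_max_left _ _)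
    · exact mul_le_mul_of_nonneg_right (le_max_right _ _) (norm_nonneg _)
  obtain ⟨⟨b', R⟩, ⟨hR, hφ⟩, rfl⟩ := crossedProduct_subset hα _ hcl (fun a g =>
    ⟨(_, ψ (leftRegular g) • hatRep κ π u a g), ⟨B''.smul_mem
      (Set.subset_centralizer_centralizer (hatRep_mem π u a g)) _, fun ξ η => by
        change ⟪ξ, ψ (leftRegular g) • hatRep κ π u a g η⟫_ℂ =
          ψ (sliceL (dualCorep G κ H) ξ η (hatRep κ π u a g))
        rw [sliceL_hatRep, map_smul, inner_smul_right, smul_eq_mul, mul_comm]⟩, rfl⟩) b hb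
  exact ⟨R, hR, fun ξ η => ⟨⟨_, hmem ξ η⟩, rfl, (hφ ξ η).trans (hψ ⟨_, hmem ξ η⟩)⟩⟩

theorem exists_dualCoaction {α : G →* (A ≃⋆ₐ[ℂ] A)}
    (hα : ∀ g a ξ, π (α g a) ξ = u g (π a ((u g).symm ξ)))
    (D : H →ₗ.[ℂ] H) (p : Equiv.Perm (G × κ)) (hp : ∀ q, (p q).1 = q.1)
    (c : G × κ → H →L[ℂ] H) (χ : Ell2 (G × κ) H ≃ₗᵢ[ℂ] Ell2 (G × κ) H)
    (e : G × κ → H → H) (hχ : ∀ x q, χ x q = e q (x q)) :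
    ∃ θ, IsDualCoaction π u θ ∧
      IsCoactionEquivariant (crossedProduct κ π u) θ (fibreDirac D p c) χ (dualCorep G κ H) := by
  -- The coaction is defined on all of the crossed product at once, as conjugation by `U`.
  refine ⟨(conjAmpl (dualCorep G κ H)).comp (crossedProduct κ π u).subtype,
    fun a h => conjAmpl_hatRep a h, dualCorep_isUnitaryCorep,
    fun b ξ => corepMap_apply_eq _ _ _, dualCorep_tensorOneGraph D p hp c, fun y => ?_,
    fun φ _ _ b hb => exists_slice hα φ b hb⟩
  ext ⟨i, g⟩
  change χ (sliceEll2 y (i.1⁻¹ * g)) i = χ (sliceEll2 (dualCorep G κ H y) g) i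
  rw [hχ, hχ]
  rfl

/-- The real structure on the crossed product, from the corresponding relations in the fibres. -/
theorem twistedFlip_isRealStructure {α : G →* (A ≃⋆ₐ[ℂ] A)} {D : H →ₗ.[ℂ] H}
    (hu : IsInvariantTriple α π D u) {s τ : Equiv.Perm κ}
    {m : κ → H ≃ₛₗᵢ[starRingEnd ℂ] H} {p : Equiv.Perm (G × κ)} {c : G × κ → H →L[ℂ] H}
    {χ : Ell2 (G × κ) H ≃ₗᵢ[ℂ] Ell2 (G × κ) H} {e : κ → H → H} {n : ZMod 8}
    (hum : ∀ g k ξ, m k (u g ξ) = u g (m k ξ))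
    (hπ : ∀ k a b ξ, π a (m k (π b ξ)) = m k (π b ((m k).symm (π a (m k ξ)))))
    (hsq : ∀ k ξ, m k (m (s k) ξ) = koEps n • ξ) (hss : ∀ k, s (s k) = k)
    (heps : koEps n = 1 ∨ koEps n = -1)
    (huc : ∀ g q ξ, c q (u g ξ) = u g (c q ξ))
    (hp : ∀ g k, p (g, k) = (g, τ k)) (hs : ∀ k, s (τ k) = τ (s k))
    (hmd : ∀ k, ∀ ξ ∈ D.domain, m k ξ ∈ D.domain)
    (hmD : ∀ (k : κ) (ξ : H) (hξ : ξ ∈ D.domain) (h : m (τ k) ξ ∈ D.domain),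
      D ⟨m (τ k) ξ, h⟩ = koEps' n • m k (D ⟨ξ, hξ⟩))
    (hmc : ∀ g k ξ, c (g, k) (m (τ k) ξ) = koEps' n • m k (c (g⁻¹, s k) ξ))
    (hχ : ∀ x q, χ x q = e q.2 (x q))
    (hχm : ∀ g k ξ, e k (u g (m k ξ)) = koEps'' n • u g (m k (e (s k) ξ))) :
    IsRealStructure (crossedProduct κ π u : Set (Ell2 (G × κ) H →L[ℂ] Ell2 (G × κ) H))
      (fibreDirac D p c) χ n (twistedFlip u s m) := by
  have hJJ (x : Ell2 (G × κ) H) : twistedFlip u s m (twistedFlip u s m x) = koEps n • x := by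
    ext ⟨g, k⟩
    simp only [twistedFlip_apply, hum, hss, inv_inv, hsq]
    rw [← map_mul_apply, mul_inv_cancel, map_one]
    rfl
  have hdir := fibreDirac_twistedFlip hu.domain hu.commutes huc hp hs hmd hmD hmc
  refine ⟨fun a ha b hb ξ => ?_, hJJ, fun x => ⟨fun h => ?_, fun h => (hdir ⟨x, h⟩).1⟩,
    fun x hx hJx => (hdir ⟨x, hx⟩).2, fun x => ?_⟩
  · obtain ⟨η, rfl⟩ := (twistedFlip u s m).surjective ξ
    rw [LinearIsometryEquiv.symm_apply_apply]
    let L := Ell2 (G × κ) H →L[ℂ] Ell2 (G × κ) H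
    have hc (η : Ell2 (G × κ) H) : Continuous fun T : L => T η :=
      (ContinuousLinearMap.apply ℂ _ η).continuous
    -- With `ξ = Ĵ η` the condition is linear in `a` for fixed `b`. It is also preserved by linear
    -- combinations of `b`, as both sides are antilinear in `b`. So both arguments reduce to
    -- generators, one after the other.
    let M (b : L) : Submodule ℂ L :=
      { carrier := {a | a (twistedFlip u s m (b η)) =
          twistedFlip u s m (b ((twistedFlip u s m).symm (a (twistedFlip u s m η))))}
        zero_mem' := by simp
        add_mem' := fun {a a'} h h' => by
          change a _ + a' _ = twistedFlip u s m (b ((twistedFlip u s m).symm (a _ + a' _)))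
          rw [h, h', map_add, map_add, map_add]
        smul_mem' := fun c a h => by
          change c • a _ = twistedFlip u s m (b ((twistedFlip u s m).symm (c • a _)))
          rw [h, LinearIsometryEquiv.map_smulₛₗ, map_smul, LinearIsometryEquiv.map_smulₛₗ]
          simp }
    have hM (b : L) : IsClosed (M b : Set L) :=
      isClosed_eq (hc _) ((twistedFlip u s m).continuous.comp
        (b.continuous.comp ((twistedFlip u s m).symm.continuous.comp (hc _))))
    refine crossedProduct_subset hu.covariant (M b) (hM b) (fun a h => ?_) a ha
    let M' : Submodule ℂ L :=
      { carrier := {b | hatRep κ π u a h (twistedFlip u s m (b η)) = twistedFlip u s m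
          (b ((twistedFlip u s m).symm (hatRep κ π u a h (twistedFlip u s m η))))}
        zero_mem' := by simp
        add_mem' := fun {b b'} h h' => by
          change _ = twistedFlip u s m (b _ + b' _)
          rw [map_add, ← h, ← h', ← map_add, ← map_add]
          rfl
        smul_mem' := fun c b h => by
          change _ = twistedFlip u s m (c • b _)
          rw [LinearIsometryEquiv.map_smulₛₗ, ← h, ← map_smul,
            ← LinearIsometryEquiv.map_smulₛₗ]
          rfl }
    have hM' : IsClosed (M' : Set L) :=
      isClosed_eq ((hatRep κ π u a h).continuous.comp
        ((twistedFlip u s m).continuous.comp (hc _)))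
        ((twistedFlip u s m).continuous.comp (hc _))
    refine crossedProduct_subset hu.covariant M' hM' (fun a' h' => ?_) b hb
    change hatRep κ π u a h (twistedFlip u s m (hatRep κ π u a' h' η)) = twistedFlip u s m
      (hatRep κ π u a' h' ((twistedFlip u s m).symm
        (hatRep κ π u a h (twistedFlip u s m η))))
    have hum' (t : G) (k : κ) (ξ : H) : u t ((m k).symm ((u t).symm ξ)) = (m k).symm ξ := by
      apply (m k).injective
      rw [hum, LinearIsometryEquiv.apply_symm_apply, LinearIsometryEquiv.apply_symm_apply,
        LinearIsometryEquiv.apply_symm_apply]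
    -- Moving `u_t` inwards turns `a'` into `α_t(a')`. After this both sides carry `α_g(a')`, and
    -- the zeroth order condition in the fibre applies.
    have hconj (t : G) (k : κ) (ξ : H) :
        u t (m k (π a' ξ)) = m k (π (α t a') (u t ξ)) := by
      rw [← hum, hu.covariant, LinearIsometryEquiv.symm_apply_apply]
    ext ⟨g, k⟩
    rw [hatRep_apply, twistedFlip_apply, twistedFlip_apply, hatRep_apply, hatRep_apply,
      twistedFlip_symm_apply, hatRep_apply, twistedFlip_apply, s.symm_apply_apply,
      ← map_mul_apply, ← map_mul_apply, mul_inv_cancel_left, mul_inv_cancel_left, hconj, hconj,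
      ← map_mul_apply, ← map_mul_apply, hπ]
    simp only [mul_inv_rev, inv_inv, hum', hum, mul_assoc]
  -- The converse inclusion of domains: apply the direct one to `Ĵ x` and use `Ĵ² = ±1`.
  · have h' := (hdir ⟨_, h⟩).1
    change twistedFlip u s m (twistedFlip u s m x) ∈ _ at h'
    rw [hJJ] at h'
    rcases heps with h1 | h1
    · simpa [h1] using h'
    · rw [h1, neg_one_smul] at h'
      exact neg_mem_iff.1 h'
  · ext ⟨g, k⟩
    rw [hχ, twistedFlip_apply, hχm, ← hχ x (g⁻¹, s k)]
    rfl

end Algebra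

end Crossed

end CrossedTriple

/-! ### The fibre relations in each KO-dimension -/

open CrossedTriple in
theorem mainTheorem10 {A : Type*} [CStarAlgebra A]
    {H : Type*} [NormedAddCommGroup H] [InnerProductSpace ℂ H] [CompleteSpace H]
    {G : Type*} [Group G]
    (l : G → ℝ) (hl : ∀ g h, l (g * h) = l g + l h)
    (hproper : ∀ n : ℕ, {g | -(n : ℝ) ≤ l g ∧ l g ≤ n}.Finite)
    (α : G →* (A ≃⋆ₐ[ℂ] A))
    (𝒜 : StarSubalgebra ℂ A) (π : A →⋆ₐ[ℂ] (H →L[ℂ] H)) (D : H →ₗ.[ℂ] H)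
    (hT : IsSpectralTriple 𝒜 π D)
    (u : G →* (H ≃ₗᵢ[ℂ] H)) (hu : IsInvariantTriple α π D u)
    (J : H ≃ₛₗᵢ[starRingEnd ℂ] H) (hJu : ∀ g ξ, u g (J ((u g).symm ξ)) = J ξ) :
    -- the triple on `A` is odd
    (∀ n : ZMod 8, n = 1 ∨ n = 3 ∨ n = 5 ∨ n = 7 →
      IsRealStructure (Set.range π) D 1 n J →
      (∃ θ, IsDualCoaction π u θ ∧
        IsCoactionEquivariant (crossedProduct (Fin 2) π u) θ (hatDiracOdd D l) hatGradingOdd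
          (dualCorep G (Fin 2) H)) ∧
      IsRealStructure (crossedProduct (Fin 2) π u : Set _) (hatDiracOdd D l) hatGradingOdd
        (n + 1) (hatRealOdd u n J) ∧
      Intertwines (dualCorep G (Fin 2) H) (hatRealOdd u n J)) ∧
    -- the triple on `A` is even
    (∀ (n : ZMod 8) (χ : H ≃ₗᵢ[ℂ] H), n = 0 ∨ n = 2 ∨ n = 4 ∨ n = 6 →
      IsGrading π D χ → (∀ g ξ, u g (χ ξ) = χ (u g ξ)) →
      IsRealStructure (Set.range π) D χ n J →
      (∃ θ, IsDualCoaction π u θ ∧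
        IsCoactionEquivariant (crossedProduct Unit π u) θ (hatDiracEven D χ l) 1
          (dualCorep G Unit H)) ∧
      IsRealStructure (crossedProduct Unit π u : Set _) (hatDiracEven D χ l) 1
        (n + 1) (hatRealEven u χ n J) ∧
      Intertwines (dualCorep G Unit H) (hatRealEven u χ n J) ∧
      Intertwines (dualCorep G Unit H) (untwistedRealEven χ n J)) := by
  have hJu' (g : G) (ξ : H) : J (u g ξ) = u g (J ξ) := by
    rw [← hJu g (u g ξ), LinearIsometryEquiv.symm_apply_apply]
  have hJl (n : ZMod 8) (χ : H ≃ₗᵢ[ℂ] H) (hJ : IsRealStructure (Set.range π) D χ n J) (a b : A)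
      (ξ : H) : π a (J (π b ξ)) = J (π b (J.symm (π a (J ξ)))) := by
    have := hJ.zeroth_order _ ⟨a, rfl⟩ _ ⟨b, rfl⟩ (J ξ)
    rwa [J.symm_apply_apply] at this
  have hJr (r : ℝ) (ξ : H) : J (r • ξ) = r • J ξ := by
    rw [← Complex.coe_smul, J.map_smulₛₗ, Complex.conj_ofReal, Complex.coe_smul]
  have hlinv (g : G) : l g⁻¹ = -l g := by
    have h1 := hl 1 1
    have h2 := hl g g⁻¹
    rw [mul_one] at h1
    rw [mul_inv_cancel] at h2
    linarith
  have hko (n : ZMod 8) : koEps n = 1 ∨ koEps n = -1 := by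
    revert n
    decide
  refine ⟨fun n hn hJ => ⟨?_, ?_, ?_⟩, fun n χ hn hχ hχu hJ => ⟨?_, ?_, ?_, ?_⟩⟩
  · exact exists_dualCoaction hu.covariant D _ (fun _ => rfl) _ _ _ fun x q => rfl
  · by_cases h : n = 3 ∨ n = 7
    · have hk : koEps (n + 1) = koEps n ∧ koEps' n = 1 ∧ koEps' (n + 1) = 1 ∧
          koEps'' (n + 1) = 1 := by
        rcases h with rfl | rfl <;> decide
      obtain ⟨k1, k2, k3, k4⟩ := hk
      unfold hatRealOdd
      rw [if_pos h]
      refine twistedFlip_isRealStructure hu (τ := Equiv.swap 0 1)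
        (e := fun k => (![LinearIsometryEquiv.refl ℂ H, LinearIsometryEquiv.neg ℂ] :
          Fin 2 → H ≃ₗᵢ[ℂ] H) k) (fun g _ => hJu' g) (fun _ => hJl n 1 hJ) (fun _ ξ => ?_)
        (fun _ => rfl) (hko _) (fun g q ξ => ?_) (fun _ _ => rfl) (fun _ => rfl)
        (fun _ ξ => (hJ.domain ξ).2) (fun k ξ hξ hJξ => ?_) (fun g k ξ => ?_)
        (fun _ _ => rfl) (fun g k ξ => ?_)
      · rw [k1, hJ.sq]
      · simp
      · rw [k3, hJ.dirac ξ hξ hJξ, k2]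
      · rw [k3, one_smul]
        -- Two signs cancel: `J` conjugates `±i`, and `l(g⁻¹) = -l(g)`.
        fin_cases k <;> simp [hlinv, mul_smul, J.map_smulₛₗ, hJr]
      · rw [k4, one_smul]
        fin_cases k <;> simp
    · have hk : koEps (n + 1) = -koEps n ∧ koEps' n = -1 ∧ koEps' (n + 1) = 1 ∧
          koEps'' (n + 1) = -1 := by
        rcases hn with rfl | rfl | rfl | rfl
        · decide
        · exact absurd (Or.inl rfl) h
        · decide
        · exact absurd (Or.inr rfl) h
      obtain ⟨k1, k2, k3, k4⟩ := hk
      unfold hatRealOdd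
      rw [if_neg h]
      set m : Fin 2 → H ≃ₛₗᵢ[starRingEnd ℂ] H :=
        fun k => ((![unitI⁻¹, unitI] k) • LinearIsometryEquiv.refl ℂ H).trans J
      -- The entries of `σ₂` conjugated past `J`. Since `t` changes sign under the swap, it reverses
      -- `ε` and cancels `ε' = -1`.
      set t : Fin 2 → ℂ := ![Complex.I, -Complex.I] with ht
      have hm (k : Fin 2) (ξ : H) : m k ξ = t k • J ξ := by
        fin_cases k
        · change J ((star Complex.I) • ξ) = Complex.I • J ξ
          rw [J.map_smulₛₗ]
          simp
        · change J (Complex.I • ξ) = -Complex.I • J ξ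
          rw [J.map_smulₛₗ]
          simp
      have htτ (k : Fin 2) : t (Equiv.swap 0 1 k) = -t k := by
        fin_cases k <;> simp [ht]
      have htt (k : Fin 2) : t k * (starRingEnd ℂ) (t k) = 1 := by
        fin_cases k <;> simp [ht]
      refine twistedFlip_isRealStructure hu (τ := Equiv.swap 0 1)
        (e := fun k => (![LinearIsometryEquiv.refl ℂ H, LinearIsometryEquiv.neg ℂ] :
          Fin 2 → H ≃ₗᵢ[ℂ] H) k) (fun g k ξ => ?_) (fun k a b ξ => ?_) (fun k ξ => ?_)
        (fun _ => Equiv.swap_apply_self ..) (hko _) (fun g q ξ => ?_) (fun _ _ => rfl)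
        (fun _ => rfl) (fun k ξ hξ => ?_) (fun k ξ hξ hJξ => ?_) (fun g k ξ => ?_)
        (fun _ _ => rfl) (fun g k ξ => ?_)
      · rw [hm, hm, hJu', map_smul]
      -- The phases cancel under conjugation by `m k`, leaving the zeroth order condition for `J`.
      · have h1 : (m k).symm (π a (m k ξ)) = J.symm (π a (J ξ)) := by
          apply (m k).injective
          rw [LinearIsometryEquiv.apply_symm_apply, hm k (J.symm _), J.apply_symm_apply, hm,
            map_smul]
        rw [h1, hm, hm, map_smul, hJl n 1 hJ]
      · rw [hm, hm, htτ, J.map_smulₛₗ, smul_smul, map_neg, mul_neg, htt, k1, hJ.sq, neg_smul,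
          neg_smul, one_smul]
      · simp
      · rw [hm]
        exact D.domain.smul_mem _ ((hJ.domain ξ).2 hξ)
      · have hJξ' := (hJ.domain ξ).2 hξ
        have h1 : (⟨m (Equiv.swap 0 1 k) ξ, hJξ⟩ : D.domain) =
            t (Equiv.swap 0 1 k) • ⟨J ξ, hJξ'⟩ := Subtype.ext (hm _ _)
        rw [h1, D.map_smul, hJ.dirac ξ hξ, k2, k3, hm, htτ]
        simp
      · rw [k3, one_smul, hm, hm, htτ]
        fin_cases k <;> simp [ht, hlinv, mul_smul, J.map_smulₛₗ, hJr]
        exact smul_comm _ _ _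
      · rw [k4, neg_one_smul, hm, hm]
        fin_cases k <;> simp
  · unfold hatRealOdd
    split_ifs
    exacts [twistedFlip_intertwines _ _ _, twistedFlip_intertwines _ _ _]
  · exact exists_dualCoaction hu.covariant D _ (fun _ => rfl) _ _ (fun _ => id) fun x q => rfl
  · have hd := hJ.domain
    by_cases h : n = 0 ∨ n = 4
    · have hk : koEps (n + 1) = koEps n ∧ koEps' n = 1 ∧ koEps' (n + 1) = -1 ∧
          koEps'' (n + 1) = 1 ∧ koEps'' n = 1 := by
        rcases h with rfl | rfl <;> decide
      obtain ⟨k1, k2, k3, k4, k5⟩ := hk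
      unfold hatRealEven
      rw [if_pos h]
      have hm (ξ : H) : χ (J ξ) = J (χ ξ) := by rw [hJ.grading, k5, one_smul]
      refine twistedFlip_isRealStructure hu (τ := Equiv.refl _) (e := fun _ => id)
        (fun g _ ξ => ?_) (fun _ a b ξ => ?_) (fun _ ξ => ?_)
        (fun _ => rfl) (hko _) (fun g q ξ => ?_) (fun _ _ => rfl) (fun _ => rfl)
        (fun _ ξ hξ => hχ.domain _ ((hd ξ).2 hξ)) (fun k ξ hξ hJξ => ?_) (fun g k ξ => ?_)
        (fun _ _ => rfl) (fun g k ξ => ?_)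
      · change χ (J (u g ξ)) = u g (χ (J ξ))
        rw [hJu', hχu]
      · change π a (χ (J (π b ξ))) = χ (J (π b (J.symm (χ.symm (π a (χ (J ξ)))))))
        rw [hχ.commutes, hχ.commutes, χ.symm_apply_apply, hJl n χ hJ]
      · change χ (J (χ (J ξ))) = _
        rw [k1, ← hm, hχ.involutive, hJ.sq]
      · change (l q.1 : ℂ) • χ (u g ξ) = u g ((l q.1 : ℂ) • χ ξ)
        rw [map_smul, hχu]
      · change D ⟨χ (J ξ), _⟩ = _ • χ (J _)
        -- Anticommutation of `D` with `χ` supplies `ε' = -1`; the summand `χ ⊗ M_l` gets the same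
        -- sign from `l(g⁻¹) = -l(g)`.
        refine (hχ.anticommutes _ ((hd ξ).2 hξ) hJξ).trans ?_
        rw [hJ.dirac _ hξ, k2, k3, one_smul, neg_one_smul]
      · change (l g : ℂ) • χ (χ (J ξ)) = _ • χ (J ((l g⁻¹ : ℂ) • χ ξ))
        rw [k3, hlinv, J.map_smulₛₗ, ← hm, map_smul χ]
        simp
      · rw [k4, one_smul]
        rfl
    · have hk : koEps (n + 1) = koEps n ∧ koEps' n = 1 ∧ koEps' (n + 1) = 1 ∧
          koEps'' (n + 1) = 1 ∧ koEps'' n = -1 := by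
        rcases hn with rfl | rfl | rfl | rfl
        · exact absurd (Or.inl rfl) h
        · decide
        · exact absurd (Or.inr rfl) h
        · decide
      obtain ⟨k1, k2, k3, k4, k5⟩ := hk
      unfold hatRealEven
      rw [if_neg h]
      have hm (ξ : H) : χ (J ξ) = -J (χ ξ) := by rw [hJ.grading, k5, neg_one_smul]
      refine twistedFlip_isRealStructure hu (τ := Equiv.refl _) (e := fun _ => id)
        (fun g _ => hJu' g) (fun _ => hJl n χ hJ) (fun _ ξ => ?_)
        (fun _ => rfl) (hko _) (fun g q ξ => ?_) (fun _ _ => rfl) (fun _ => rfl)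
        (fun _ ξ => (hd ξ).2) (fun k ξ hξ hJξ => ?_) (fun g k ξ => ?_)
        (fun _ _ => rfl) (fun g k ξ => ?_)
      · rw [k1, hJ.sq]
      · change (l q.1 : ℂ) • χ (u g ξ) = u g ((l q.1 : ℂ) • χ ξ)
        rw [map_smul, hχu]
      · rw [hJ.dirac _ hξ, k2, k3]
      -- Here `χ J = -J χ` offsets `l(g⁻¹) = -l(g)`, so no factor `χ` is needed in `Ĵ`.
      · change (l g : ℂ) • χ (J ξ) = _ • J ((l g⁻¹ : ℂ) • χ ξ)
        rw [k3, hlinv, hm, J.map_smulₛₗ]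
        simp
      · rw [k4, one_smul]
        rfl
  · unfold hatRealEven
    split_ifs
    exacts [twistedFlip_intertwines _ _ _, twistedFlip_intertwines _ _ _]
  -- The untwisted maps are twisted flips for the trivial representation.
  · unfold untwistedRealEven hatRealEven
    split_ifs
    exacts [twistedFlip_intertwines _ _ _, twistedFlip_intertwines _ _ _]
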